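/- Let $G$ be an amenable locally compact (Hausdorff) group with a fixed (regular) left Haar measure $\lambda$ and modular function $\Delta$, normalised by $\lambda(Ex)=\Delta(x)\lambda(E)$. Amenability means that there is a left invariant mean on $L^\infty(G)$. Let $1<p<\infty$, let $q$ be the conjugate exponent, $\frac1p+\frac1q=1$, and put $\omega_q=\Delta^{-1/q}$. Let $L^1(G,\omega_q)$ be the set of complex functions $f$ on $G$ with $f\omega_q\in L^1(G)$. For complex functions $g,f$ put $(g*f)(x)=\int_G g(y)f(y^{-1}x)\,d\lambda(y)$, and say that $g*f$ exists if for almost every $x$ the integrand $y\mapsto g(y)f(y^{-1}x)$ is integrable. A function $f\in L^p(G)$ is called an $L^T_p$-function, written $f\in L^T_p(G)$, if for every $g\in L^p(G)$ the convolution $g*f$ exists and belongs to $L^p(G)$, and $$\|f\|_p^T=\sup\{\|g*f\|_p : g\in L^p(G),\ \|g\|_p\le 1\}<\infty .$$ For a space $X$ of functions, let $X^+$ be the set of those $f\in X$ with $f\ge 0$ almost everywhere. Then $$L^1(G,\omega_q)\cap L^p(G)^+=L^T_p(G)^+ .$$ -/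

import Mathlib

open MeasureTheory
open scoped ENNReal NNReal

namespace LpT

noncomputable section

variable {G : Type*} [Group G] [TopologicalSpace G] [IsTopologicalGroup G] [LocallyCompactSpace G]

/-- The modular function `Δ` of `G`, normalised as usual by `λ(E x) = Δ(x) λ(E)` for a left Haar
measure `λ` (see `measure_mul_right`). Mathlib's modular character is normalised by
`λ(E x⁻¹) = Δ(x) λ(E)`, hence the inverse. -/
def modular (x : G) : ℝ :=
  (Measure.modularCharacterFun x⁻¹ : ℝ≥0)

/-- The normalisation of `modular`: `λ(E x) = Δ(x) λ(E)`, with `E x` written as the preimage of `E`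
under right translation by `x⁻¹`. -/
theorem measure_mul_right [MeasurableSpace G] [BorelSpace G] (μ : Measure G) [μ.IsHaarMeasure]
    [μ.Regular] (x : G) {E : Set G} (hE : MeasurableSet E) :
    μ ((fun y => y * x⁻¹) ⁻¹' E) = ENNReal.ofReal (modular x) * μ E := by
  have : (Measure.map (· * x⁻¹) μ).Regular :=
    Measure.Regular.map (Homeomorph.mulRight x⁻¹)
  have h := Measure.isMulLeftInvariant_eq_smul_of_regular (Measure.map (· * x⁻¹) μ) μ
  rw [← Measure.modularCharacterFun_eq_haarScalarFactor μ x⁻¹] at h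
  have h2 := congrArg (fun ν : Measure G => ν E) h
  simp only [Measure.smul_apply] at h2
  rw [Measure.map_apply (measurable_mul_const _) hE] at h2
  rw [h2, modular, ENNReal.ofReal_coe_nnreal]
  rfl

/-- The weight `ω_q = Δ ^ (-1/q)`. -/
def weight (q : ℝ) (x : G) : ℝ :=
  modular x ^ (-(1 / q))

end

noncomputable section

variable {G : Type*} [Group G] [MeasurableSpace G]

/-- The convolution `(f * g)(x) = ∫ f(y) g(y⁻¹ x) dμ(y)`. -/
def conv (μ : Measure G) (f g : G → ℂ) (x : G) : ℂ :=
  ∫ y, f y * g (y⁻¹ * x) ∂μ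

/-- The convolution `f * g` exists: for almost every `x`, the function `y ↦ f(y) g(y⁻¹ x)` is
integrable. -/
def ConvExists (μ : Measure G) (f g : G → ℂ) : Prop :=
  ∀ᵐ x ∂μ, Integrable (fun y => f y * g (y⁻¹ * x)) μ

/-- `‖f‖_p^T = sup {‖g * f‖_p : g ∈ L^p(G), ‖g‖_p ≤ 1}`, with values in `[0, ∞]`. -/
def normT (μ : Measure G) (p : ℝ) (f : G → ℂ) : ℝ≥0∞ :=
  ⨆ (g : G → ℂ) (_ : MemLp g (ENNReal.ofReal p) μ) (_ : eLpNorm g (ENNReal.ofReal p) μ ≤ 1),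
    eLpNorm (conv μ g f) (ENNReal.ofReal p) μ

/-- `f` is an `L^T_p`-function: `f ∈ L^p(G)`, for every `g ∈ L^p(G)` the convolution `g * f` exists
and lies in `L^p(G)`, and `‖f‖_p^T < ∞`. -/
structure IsLTp (μ : Measure G) (p : ℝ) (f : G → ℂ) : Prop where
  memLp : MemLp f (ENNReal.ofReal p) μ
  convExists : ∀ g : G → ℂ, MemLp g (ENNReal.ofReal p) μ → ConvExists μ g f
  conv_memLp : ∀ g : G → ℂ, MemLp g (ENNReal.ofReal p) μ →
    MemLp (conv μ g f) (ENNReal.ofReal p) μ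
  normT_lt_top : normT μ p f < ∞

/-- `f` is positive: almost everywhere, its value is a real number `≥ 0`. -/
def IsPos (μ : Measure G) (f : G → ℂ) : Prop :=
  ∀ᵐ x ∂μ, 0 ≤ (f x).re ∧ (f x).im = 0

/-- Membership in the weighted space `L^1(G, ω)`: `f ω ∈ L^1(G)`. -/
def MemL1Weighted (μ : Measure G) (ω : G → ℝ) (f : G → ℂ) : Prop :=
  Integrable (fun x => f x * (ω x : ℂ)) μ

/-- Amenability of `G`, with left Haar measure `μ`: there is a left invariant mean on
`L^∞(G)`, that is, a positive linear functional `m` with `m 1 = 1` and `m (F (x ·)) = m F` for all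
`x ∈ G` and `F ∈ L^∞(G)`. -/
def IsAmenable [MeasurableMul G] (μ : Measure G) [μ.IsMulLeftInvariant] : Prop :=
  ∃ m : Lp ℝ ∞ μ →ₗ[ℝ] ℝ,
    (∀ F : Lp ℝ ∞ μ, 0 ≤ F → 0 ≤ m F) ∧
    m ((memLp_top_const (1 : ℝ)).toLp (fun _ : G => (1 : ℝ))) = 1 ∧
    ∀ (x : G) (F : Lp ℝ ∞ μ),
      m (Lp.compMeasurePreserving (fun y => x * y) (measurePreserving_mul_left μ x) F) = m F

end

end LpT

namespace LpT

/-! ### Compact supports under the group operations. -/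

section Support

variable {G : Type*} [Group G] [TopologicalSpace G] [IsTopologicalGroup G]

/-! One inclusion is Minkowski's inequality. Substituting `y = x z⁻¹` writes `g * f` as the
superposition of the right translates `g (· z⁻¹)` with density `f Δ⁻¹`. Such a translate has norm
`Δ(z)^(1/p) ‖g‖_p`, and `1/p - 1 = -1/q`, so `‖g * f‖_p ≤ ‖g‖_p ∫ |f| ω_q`. Neither positivity nor
amenability is needed here. As `G` need not be σ-compact, Fubini is used only on continuous
functions of compact support (`integral_conv_rpow_le`). General `f` and `g` are expanded in
absolutely convergent series of such functions, which costs a harmless additive constant in the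
bound (`exists_conv_bound`).

For the converse, pair `g * f` with a test function `k`: for `g, k ≥ 0` of norm one in `L^p` and
`L^q`, Hölder gives `∫ f(z) θ(z) dz ≤ ‖f‖_p^T`, where `θ(z) = ∫ g(y) k(y z) dy`. Amenability
provides, for each compact `K`, such `g` and `k` with `θ ≥ ω_q / 2` on `K`
(`exists_test_functions`). Hence `∫_K f ω_q ≤ 2 ‖f‖_p^T` uniformly in `K`, and since `f` is carried
by a σ-compact set, monotone convergence finishes the proof.

The functions `g` and `k` come from Reiter's condition, that is, a function of integral one in `L^1`
almost fixed by translation by every element of `K`. It follows from the invariant mean by Day's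
argument: if convolutions with a fixed kernel could not be made almost invariant, Hahn–Banach would
give a bounded function on `G` with a positive lower bound but mean zero. -/

theorem _root_.HasCompactSupport.comp_mul_left {E : Type*} [Zero E] {φ : G → E}
    (h : HasCompactSupport φ) (x : G) : HasCompactSupport fun y => φ (x * y) :=
  h.comp_homeomorph (Homeomorph.mulLeft x)

theorem _root_.HasCompactSupport.comp_mul_right {E : Type*} [Zero E] {φ : G → E}
    (h : HasCompactSupport φ) (x : G) : HasCompactSupport fun y => φ (y * x) :=
  h.comp_homeomorph (Homeomorph.mulRight x)

theorem _root_.HasCompactSupport.comp_inv {E : Type*} [Zero E] {φ : G → E}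
    (h : HasCompactSupport φ) : HasCompactSupport fun y => φ y⁻¹ :=
  h.comp_homeomorph (Homeomorph.inv G)

/-- A function of `(x, y)` of the form `H (x, y)` vanishing unless `x` and `y⁻¹ * x` lie in given
compact sets has compact support. -/
theorem hasCompactSupport_of_inv_mul {E : Type*} [Zero E] [T2Space G] {φ ψ : G → ℝ}
    (hφ : HasCompactSupport φ) (hψ : HasCompactSupport ψ) {H : G × G → E}
    (h : ∀ x y, H (x, y) ≠ 0 → φ x ≠ 0 ∧ ψ (y⁻¹ * x) ≠ 0) : HasCompactSupport H := by
  have hK := (IsCompact.prod (s := tsupport φ) (t := tsupport ψ) hφ hψ).image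
    (show Continuous fun z : G × G => (z.1, z.1 * z.2⁻¹) by fun_prop)
  refine HasCompactSupport.intro hK fun z hz => ?_
  by_contra hne
  obtain ⟨h1, h2⟩ := h z.1 z.2 hne
  exact hz ⟨(z.1, z.2⁻¹ * z.1), ⟨subset_tsupport _ h1, subset_tsupport _ h2⟩, by simp⟩

end Support

/-! ### The modular function and inversion of Haar measure. -/

section Modular

open Measure Filter Topology

variable {G : Type*} [Group G] [TopologicalSpace G] [IsTopologicalGroup G] [LocallyCompactSpace G]

theorem modular_pos (x : G) : 0 < modular x :=
  NNReal.coe_pos.2 (modularCharacterFun_pos x⁻¹)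

theorem modular_mul (x y : G) : modular (x * y) = modular x * modular y := by
  simp only [modular, mul_inv_rev, modularCharacterFun_map_mul, NNReal.coe_mul]
  ring

theorem modular_one : modular (1 : G) = 1 := by
  simp [modular, modularCharacterFun_map_one]

theorem modular_inv (x : G) : modular x⁻¹ = (modular x)⁻¹ :=
  eq_inv_of_mul_eq_one_left (by rw [← modular_mul, inv_mul_cancel, modular_one])

theorem weight_pos (q : ℝ) (x : G) : 0 < weight q x :=
  Real.rpow_pos_of_pos (modular_pos x) _

variable [MeasurableSpace G] [BorelSpace G] (μ : Measure G) [μ.IsHaarMeasure] [μ.Regular]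

theorem integral_comp_mul_right {E : Type*} [NormedAddCommGroup E] [NormedSpace ℝ E]
    (φ : G → E) (x : G) : ∫ y, φ (y * x) ∂μ = (modular x)⁻¹ • ∫ y, φ y ∂μ := by
  have : (Measure.map (· * x) μ).Regular := Measure.Regular.map (Homeomorph.mulRight x)
  have h := isMulLeftInvariant_eq_smul_of_regular (Measure.map (· * x) μ) μ
  rw [← modularCharacterFun_eq_haarScalarFactor μ x] at h
  have h2 : ∫ y, φ (y * x) ∂μ = ∫ y, φ y ∂(Measure.map (· * x) μ) :=
    (integral_map_equiv (Homeomorph.mulRight x).toMeasurableEquiv φ).symm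
  rw [h2, h, integral_smul_nnreal_measure, ← modular_inv, modular, inv_inv]
  rfl

/-- For a bump function `φ`, `Δ(x)⁻¹ ∫ φ` is the integral of the right translate of `φ` by `x`,
which depends continuously on `x`. -/
theorem continuous_modular : Continuous (modular : G → ℝ) := by
  borelize G
  let μ : Measure G := haar
  obtain ⟨⟨φ, hφ⟩, hφc, hφ0, hφ1⟩ := exists_continuous_nonneg_pos (1 : G)
  have hpos : 0 < ∫ x, φ x ∂μ :=
    hφ.integral_pos_of_hasCompactSupport_nonneg_nonzero hφc hφ0 hφ1
  have hreg : μ.Regular := inferInstance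
  have h1 : Continuous fun x : G => ∫ y, φ (y⁻¹ * x) ∂μ.inv :=
    continuous_integral_apply_inv_mul hφ hφc
  have h2 : (fun x : G => ∫ y, φ (y⁻¹ * x) ∂μ.inv) = fun x => (modular x)⁻¹ * ∫ y, φ y ∂μ := by
    ext x
    have := integral_comp_mul_right μ φ x
    rw [smul_eq_mul] at this
    rw [← this]
    have h3 := integral_map_equiv (μ := μ) (MeasurableEquiv.inv G) (fun y => φ (y⁻¹ * x))
    simpa [Measure.inv] using h3
  rw [h2] at h1
  have h3 := (h1.div_const (∫ y, φ y ∂μ)).inv₀ (fun x => by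
    have := modular_pos x
    positivity)
  refine h3.congr fun x => ?_
  simp only [Pi.inv_apply]
  field_simp

theorem continuous_weight (q : ℝ) : Continuous (weight q : G → ℝ) :=
  continuous_modular.rpow_const fun x => Or.inl (modular_pos x).ne'

variable [T2Space G]

/-- Both sides, multiplied by `∫ k` for a bump function `k`, are values of the double integral of
`k(x) φ(y⁻¹ x)`, taken in the two orders. -/
theorem integral_comp_inv_of_hasCompactSupport {φ : G → ℝ} (hφ : Continuous φ)
    (hφc : HasCompactSupport φ) : ∫ y, φ y⁻¹ ∂μ = ∫ y, φ y * (modular y)⁻¹ ∂μ := by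
  obtain ⟨⟨k, hk⟩, hkc, hk0, hk1⟩ := exists_continuous_nonneg_pos (1 : G)
  simp only [ContinuousMap.coe_mk] at hkc hk0 hk1
  have hpos : 0 < ∫ x, k x ∂μ :=
    hk.integral_pos_of_hasCompactSupport_nonneg_nonzero hkc hk0 hk1
  have e1 : ∀ x, ∫ y, k x * φ (y⁻¹ * x) ∂μ = k x * ∫ y, φ y⁻¹ ∂μ := fun x => by
    rw [integral_const_mul, ← integral_mul_left_eq_self (fun y => φ (y⁻¹ * x)) x]
    simp
  have e2 : ∀ y, ∫ x, k x * φ (y⁻¹ * x) ∂μ = ∫ x, k (y * x) * φ x ∂μ := fun y => by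
    rw [← integral_mul_left_eq_self (fun x => k x * φ (y⁻¹ * x)) y]
    simp
  have e3 : ∀ x, ∫ y, k (y * x) * φ x ∂μ = (φ x * (modular x)⁻¹) * ∫ y, k y ∂μ := fun x => by
    rw [integral_mul_const, integral_comp_mul_right, smul_eq_mul]
    ring
  have s1 : ∫ x, ∫ y, k x * φ (y⁻¹ * x) ∂μ ∂μ = ∫ y, ∫ x, k x * φ (y⁻¹ * x) ∂μ ∂μ := by
    apply integral_integral_swap_of_hasCompactSupport
    · fun_prop
    · exact hasCompactSupport_of_inv_mul hkc hφc fun x y h => by simpa [not_or] using h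
  have s2 : ∫ y, ∫ x, k (y * x) * φ x ∂μ ∂μ = ∫ x, ∫ y, k (y * x) * φ x ∂μ ∂μ := by
    apply integral_integral_swap_of_hasCompactSupport
    · fun_prop
    · have hK := (IsCompact.prod (s := tsupport k) (t := tsupport φ) hkc hφc).image
        (show Continuous fun z : G × G => (z.1 * z.2⁻¹, z.2) by fun_prop)
      refine HasCompactSupport.intro hK fun z hz => ?_
      by_contra hne
      have : k (z.1 * z.2) ≠ 0 ∧ φ z.2 ≠ 0 := by
        simpa [Function.uncurry, not_or] using hne
      exact hz ⟨(z.1 * z.2, z.2), ⟨subset_tsupport _ this.1, subset_tsupport _ this.2⟩, by simp⟩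
  simp only [e1, e2] at s1
  simp only [e3] at s2
  rw [s2, integral_mul_const, integral_mul_const, mul_comm] at s1
  exact mul_right_cancel₀ hpos.ne' s1

/-- By inner regularity of the open set `U⁻¹` it suffices to bound compact `K ⊆ U⁻¹`. A Urysohn
function for `K⁻¹ ⊆ U` reduces this to the inversion formula on continuous functions. -/
theorem measure_inv_le_of_isOpen {U : Set G} (hU : IsOpen U) (hfin : μ U ≠ ∞) {C : ℝ≥0}
    (hC : ∀ x ∈ U, (modular x)⁻¹ ≤ C) : μ U⁻¹ ≤ C * μ U := by
  rw [hU.inv.measure_eq_iSup_isCompact]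
  refine iSup₂_le fun K hKU => iSup_le fun hK => ?_
  obtain ⟨φ, hφ1, hφc, hφU, hφr⟩ := exists_continuousMap_one_of_isCompact_subset_isOpen hK.inv hU
    (by simpa using Set.inv_subset_inv.2 hKU)
  have hφc' : HasCompactSupport φ := hφc
  have i1 : Integrable (fun y => φ y⁻¹) μ :=
    (φ.continuous.comp continuous_inv).integrable_of_hasCompactSupport hφc'.comp_inv
  have i2 : Integrable φ μ := φ.continuous.integrable_of_hasCompactSupport hφc'
  have hΔ : Continuous fun y : G => (modular y)⁻¹ :=
    continuous_modular.inv₀ fun y => (modular_pos y).ne'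
  have hzero : ∀ y, y ∉ U → φ y = 0 := fun y hy =>
    image_eq_zero_of_notMem_tsupport fun h => hy (hφU h)
  have h1 : μ.real K ≤ C * μ.real U := calc
    μ.real K = ∫ y, K.indicator (fun _ => (1 : ℝ)) y ∂μ := by
      rw [integral_indicator hK.measurableSet]; simp
    _ ≤ ∫ y, φ y⁻¹ ∂μ := by
      refine integral_mono ((integrable_indicator_iff hK.measurableSet).2
        (integrableOn_const hK.measure_lt_top.ne)) i1 fun y => ?_
      by_cases hy : y ∈ K
      · simp [hy, hφ1 (Set.inv_mem_inv.2 hy)]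
      · simpa [hy] using (hφr y⁻¹).1
    _ = ∫ y, φ y * (modular y)⁻¹ ∂μ := integral_comp_inv_of_hasCompactSupport μ φ.continuous hφc'
    _ ≤ ∫ y, U.indicator (fun _ => (C : ℝ)) y ∂μ := by
      refine integral_mono ((φ.continuous.mul hΔ).integrable_of_hasCompactSupport
        hφc'.mul_right) ((integrable_indicator_iff hU.measurableSet).2
        (integrableOn_const hfin)) fun y => ?_
      by_cases hy : y ∈ U
      · simp only [hy, Set.indicator_of_mem]
        calc φ y * (modular y)⁻¹ ≤ 1 * C :=
              mul_le_mul (hφr y).2 (hC y hy) (inv_nonneg.2 (modular_pos y).le) zero_le_one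
          _ = C := one_mul _
      · simp [hy, hzero y hy]
    _ = C * μ.real U := by
      rw [integral_indicator hU.measurableSet]; simp [mul_comm]
  calc μ K = ENNReal.ofReal (μ.real K) := (ofReal_measureReal hK.measure_lt_top.ne).symm
    _ ≤ ENNReal.ofReal (C * μ.real U) := ENNReal.ofReal_le_ofReal h1
    _ = C * μ U := by
      rw [ENNReal.ofReal_mul C.coe_nonneg, ENNReal.ofReal_coe_nnreal, ofReal_measureReal hfin]

/-- Cutting `N` along the open sets `Δ⁻¹ < n` makes the density of inversion bounded, and outer
regularity then reduces to open sets. This lets a.e. statements be pulled back along `y ↦ y⁻¹ x` for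
every single `x`. -/
theorem measure_inv_eq_zero {N : Set G} (hN : μ N = 0) : μ N⁻¹ = 0 := by
  have hcov : N⁻¹ ⊆ ⋃ n : ℕ, (N ∩ {x | (modular x)⁻¹ < n})⁻¹ := fun x hx => by
    obtain ⟨n, hn⟩ := exists_nat_gt (modular x⁻¹)⁻¹
    exact Set.mem_iUnion.2 ⟨n, hx, hn⟩
  refine measure_mono_null hcov (measure_iUnion_null fun n => ?_)
  have hV : IsOpen {x : G | (modular x)⁻¹ < n} :=
    isOpen_lt (continuous_modular.inv₀ fun y => (modular_pos y).ne') continuous_const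
  refine le_antisymm (ENNReal.le_of_forall_pos_le_add fun ε hε _ => ?_) zero_le
  -- The denominator is `n + 1` so that `n = 0` is allowed.
  obtain ⟨U, hNU, hU, hUε⟩ := N.exists_isOpen_lt_of_lt (μ := μ) (ε / (n + 1 : ℝ≥0) : ℝ≥0)
    (by rw [hN]; exact_mod_cast div_pos hε (by positivity))
  have hUV : μ (U ∩ {x : G | (modular x)⁻¹ < n}) ≤ (ε / (n + 1 : ℝ≥0) : ℝ≥0) :=
    (measure_mono Set.inter_subset_left).trans hUε.le
  calc μ (N ∩ {x | (modular x)⁻¹ < n})⁻¹ ≤ μ (U ∩ {x | (modular x)⁻¹ < n})⁻¹ :=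
        measure_mono (Set.inv_subset_inv.2 (Set.inter_subset_inter_left _ hNU))
    _ ≤ ((n : ℝ≥0) : ℝ≥0∞) * μ (U ∩ {x | (modular x)⁻¹ < n}) :=
        measure_inv_le_of_isOpen μ (hU.inter hV) (hUV.trans_lt ENNReal.coe_lt_top).ne
          fun x hx => by simpa using (le_of_lt hx.2)
    _ ≤ ((n : ℝ≥0) : ℝ≥0∞) * (ε / (n + 1 : ℝ≥0) : ℝ≥0) := by gcongr
    _ ≤ 0 + ε := by
      rw [zero_add, ← ENNReal.coe_mul, ENNReal.coe_le_coe, mul_div_left_comm]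
      exact mul_le_of_le_one_right' (div_le_one_of_le₀ (by simp) (by positivity))

theorem quasiMeasurePreserving_inv : QuasiMeasurePreserving (fun x : G => x⁻¹) μ μ := by
  refine ⟨measurable_inv, AbsolutelyContinuous.mk fun N hN h0 => ?_⟩
  rw [map_apply measurable_inv hN]
  exact measure_inv_eq_zero μ h0

theorem quasiMeasurePreserving_inv_mul (x : G) :
    QuasiMeasurePreserving (fun y : G => y⁻¹ * x) μ μ := by
  have := (quasiMeasurePreserving_inv μ).comp
    (measurePreserving_mul_left μ x⁻¹).quasiMeasurePreserving
  convert this using 2 with y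
  simp

end Modular

/-! ### Expansion of `L^p` functions in series of continuous functions. -/

section Series

open Filter Topology

/-- Integrability of `h` is a conclusion: `h` agrees a.e. with the sum of the series in `L^1`. This
later yields the existence of the convolution. -/
theorem integrable_and_hasSum_integral {α E ι : Type*} [Countable ι] {mα : MeasurableSpace α}
    {μ : Measure α} [NormedAddCommGroup E] [NormedSpace ℝ E] [CompleteSpace E] {F : ι → α → E}
    {h : α → E} (hF : ∀ i, Integrable (F i) μ) (hs : Summable fun i => ∫ y, ‖F i y‖ ∂μ)
    (hh : ∀ᵐ y ∂μ, HasSum (fun i => F i y) (h y)) :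
    Integrable h μ ∧ HasSum (fun i => ∫ y, F i y ∂μ) (∫ y, h y ∂μ) := by
  have hh' : h =ᵐ[μ] fun y => ∑' i, F i y := hh.mono fun y hy => hy.tsum_eq.symm
  refine ⟨?_, ?_⟩
  · have hfin : ∑' i, ‖(hF i).toL1 (F i)‖ₑ ≠ ∞ := by
      rw [tsum_enorm_ne_top_iff_summable_norm]
      simpa only [L1.norm_of_fun_eq_integral_norm] using hs
    refine (L1.integrable_coeFn (∑' i, (hF i).toL1 (F i))).congr ?_
    filter_upwards [Lp.hasSum_coeFn_tsum hfin, hh,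
      ae_all_iff.2 fun i => (hF i).coeFn_toL1] with y h1 h2 h3
    simp only [h3] at h1
    exact h1.unique h2
  · rw [integral_congr_ae hh']
    exact hasSum_integral_of_summable_integral_norm hF hs

variable {α E : Type*} [TopologicalSpace α] [T2Space α] [LocallyCompactSpace α]
  [MeasurableSpace α] [BorelSpace α] {μ : Measure α} [μ.Regular]
  [NormedAddCommGroup E] [NormedSpace ℝ E] [CompleteSpace E]

omit [CompleteSpace E] in
/-- Continuous functions with compact support are dense in `L^p`, `p < ∞`, over a locally compact
Hausdorff space that need not be normal. -/
theorem exists_hasCompactSupport_eLpNorm_sub_le {p : ℝ≥0∞} (hp : p ≠ ∞) {f : α → E}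
    (hf : MemLp f p μ) {ε : ℝ≥0∞} (hε : ε ≠ 0) :
    ∃ g : α → E, eLpNorm (f - g) p μ ≤ ε ∧ Continuous g ∧ MemLp g p μ ∧ HasCompactSupport g := by
  apply hf.induction_dense hp _ _ _ _ hε
  rotate_left
  · rintro f g ⟨f_cont, f_mem, hf⟩ ⟨g_cont, g_mem, hg⟩
    exact ⟨f_cont.add g_cont, f_mem.add g_mem, hf.add hg⟩
  · rintro f ⟨_, f_mem, _⟩
    exact f_mem.aestronglyMeasurable
  intro c t ht htμ ε hε
  obtain ⟨δ, δpos, hδ⟩ := exists_Lp_half E μ p hε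
  obtain ⟨η, ηpos, hη⟩ : ∃ η : ℝ≥0, 0 < η ∧ ∀ s : Set α, μ s ≤ η →
      eLpNorm (s.indicator fun _ => c) p μ ≤ δ := exists_eLpNorm_indicator_le hp c δpos.ne'
  have ηpos' : (η : ℝ≥0∞) ≠ 0 := (ENNReal.coe_pos.2 ηpos).ne'
  -- Sandwich a compact `s ⊆ t` and an open `V ⊇ s`: the two errors live on `t \ s` and `V \ s`, and
  -- Urysohn for compact inside open replaces normality.
  obtain ⟨s, st, hs, hμs⟩ := ht.exists_isCompact_sdiff_lt htμ.ne ηpos'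
  obtain ⟨V, sV, V_open, -, hV⟩ := hs.measurableSet.exists_isOpen_sdiff_lt
    (hs.measure_lt_top (μ := μ)).ne ηpos'
  obtain ⟨g, hg1, hgc, hgV, hgr⟩ := exists_continuousMap_one_of_isCompact_subset_isOpen hs V_open sV
  have hgc' : HasCompactSupport fun x => g x • c := HasCompactSupport.smul_right (f := g) hgc
  have hgm : MemLp (fun x => g x • c) p μ :=
    (by fun_prop : Continuous fun x => g x • c).memLp_of_hasCompactSupport hgc'
  have hsm : AEStronglyMeasurable (s.indicator fun _ => c) μ :=
    aestronglyMeasurable_const.indicator hs.measurableSet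
  have htm : AEStronglyMeasurable (t.indicator fun _ => c) μ :=
    aestronglyMeasurable_const.indicator ht
  have I1 : eLpNorm ((s.indicator fun _ => c) - t.indicator fun _ => c) p μ ≤ δ := by
    rw [← eLpNorm_neg, neg_sub, ← Set.indicator_sdiff st]
    exact hη _ hμs.le
  have I2 : eLpNorm ((fun x => g x • c) - s.indicator fun _ => c) p μ ≤ δ := by
    refine le_trans (eLpNorm_mono fun x => ?_) (hη _ hV.le)
    by_cases hx : x ∈ s
    · simp [hx, hg1 hx]
    by_cases hxV : x ∈ V
    · simp only [Pi.sub_apply, hx, not_false_eq_true, Set.indicator_of_notMem, sub_zero, norm_smul,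
        Set.mem_sdiff, hxV, and_self, Set.indicator_of_mem]
      rw [Real.norm_of_nonneg (hgr x).1]
      exact mul_le_of_le_one_left (norm_nonneg _) (hgr x).2
    · have : g x = 0 := image_eq_zero_of_notMem_tsupport fun h => hxV (hgV h)
      simp [hx, hxV, this]
  refine ⟨fun x => g x • c, ?_, by fun_prop, hgm, hgc'⟩
  have := (hδ _ _ (hgm.1.sub hsm) (hsm.sub htm) I2 I1).le
  rwa [sub_add_sub_cancel] at this

omit [CompleteSpace E] in
/-- A function in `L^p`, `p < ∞`, is almost everywhere the sum of a series of continuous compactly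
supported functions that converges absolutely in `L^p`. -/
theorem exists_hasSum_continuous {p : ℝ≥0∞} (hp1 : 1 ≤ p) (hp : p ≠ ∞) {h : α → E}
    (hh : MemLp h p μ) :
    ∃ ψ : ℕ → α → E, (∀ n, Continuous (ψ n)) ∧ (∀ n, HasCompactSupport (ψ n)) ∧
      ∑' n, eLpNorm (ψ n) p μ ≤ eLpNorm h p μ + 5 ∧
      ∀ᵐ x ∂μ, HasSum (fun n => ψ n x) (h x) := by
  have hδ : ∀ n : ℕ, (2⁻¹ : ℝ≥0∞) ^ n ≠ 0 := fun n => by simp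
  choose g hgh hg hgm hgc using fun n => exists_hasCompactSupport_eLpNorm_sub_le hp hh (hδ n)
  -- Telescoping: the first term has norm at most `‖h‖ + 1` and the later ones at most `2 · 2⁻ⁿ`,
  -- whence the total `‖h‖ + 5`.
  let ψ : ℕ → α → E := fun n => Nat.casesOn n (g 0) fun n => g (n + 1) - g n
  have hψ : ∀ n x, ∑ i ∈ Finset.range (n + 1), ψ i x = g n x := fun n x => by
    induction n with
    | zero => simp [ψ]
    | succ n ih => rw [Finset.sum_range_succ, ih]; simp [ψ]
  have hψc : ∀ n, Continuous (ψ n) := fun n => by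
    cases n with
    | zero => exact hg 0
    | succ n => exact (hg _).sub (hg _)
  have hψs : ∀ n, HasCompactSupport (ψ n) := fun n => by
    cases n with
    | zero => exact hgc 0
    | succ n => exact (hgc _).sub (hgc _)
  have hsum : ∑' n, eLpNorm (ψ n) p μ ≤ eLpNorm h p μ + 5 := by
    rw [tsum_eq_zero_add' ENNReal.summable]
    have h0 : eLpNorm (ψ 0) p μ ≤ eLpNorm h p μ + 1 := by
      have : ψ 0 = h - (h - g 0) := by simp [ψ]
      rw [this]
      refine (eLpNorm_sub_le hh.1 (hh.1.sub (hgm 0).1) hp1).trans ?_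
      gcongr
      simpa using hgh 0
    have h1 : ∀ n, eLpNorm (ψ (n + 1)) p μ ≤ 2 * 2⁻¹ ^ n := fun n => by
      have : ψ (n + 1) = (h - g n) - (h - g (n + 1)) := by simp [ψ]
      rw [this, two_mul]
      refine (eLpNorm_sub_le (hh.1.sub (hgm _).1) (hh.1.sub (hgm _).1) hp1).trans ?_
      refine add_le_add (hgh n) ((hgh (n + 1)).trans ?_)
      exact pow_le_pow_right_of_le_one' (by simp) (Nat.le_succ n)
    calc _ ≤ (eLpNorm h p μ + 1) + ∑' n : ℕ, 2 * (2⁻¹ : ℝ≥0∞) ^ n :=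
          add_le_add h0 (ENNReal.tsum_le_tsum h1)
      _ = eLpNorm h p μ + 5 := by
        rw [ENNReal.tsum_mul_left, ENNReal.tsum_geometric, ENNReal.one_sub_inv_two, inv_inv,
          add_assoc]
        norm_num
  refine ⟨ψ, hψc, hψs, hsum, ?_⟩
  have hS := summable_norm_of_tsum_eLpNorm_ne_top hp1
    (fun n => ((hψc n).stronglyMeasurable_of_hasCompactSupport (hψs n)).aestronglyMeasurable)
    (hsum.trans_lt (ENNReal.add_lt_top.2 ⟨hh.2, by simp⟩)).ne
  have hlim : Tendsto (fun n => eLpNorm (g n - h) p μ) atTop (𝓝 0) := by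
    refine tendsto_of_tendsto_of_tendsto_of_le_of_le tendsto_const_nhds
      (ENNReal.tendsto_pow_atTop_nhds_zero_of_lt_one (r := 2⁻¹) (by simp)) (fun _ => zero_le)
      fun n => ?_
    rw [eLpNorm_sub_comm]
    exact hgh n
  -- The series already converges absolutely a.e., so a subsequence of partial sums is enough to
  -- identify its sum.
  obtain ⟨ns, hns, hae⟩ := (tendstoInMeasure_of_tendsto_eLpNorm (zero_lt_one.trans_le hp1).ne'
    (fun n => (hgm n).1) hh.1 hlim).exists_seq_tendsto_ae
  filter_upwards [hS, hae] with x h1 h2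
  refine hasSum_of_subseq_of_summable h1
    (tendsto_finset_range.comp ((tendsto_add_atTop_nat 1).comp hns.tendsto_atTop)) ?_
  simpa [Function.comp_def, hψ] using h2

end Series

/-! ### Weighted Minkowski inequality and the inclusion into `L^T_p`. -/

section Minkowski

variable {G : Type*} [Group G] [TopologicalSpace G] [IsTopologicalGroup G] [LocallyCompactSpace G]
  [MeasurableSpace G] [BorelSpace G] (μ : Measure G) [μ.IsHaarMeasure] [μ.Regular]

omit [LocallyCompactSpace G] [μ.Regular] in
theorem continuous_integral_mul_inv_mul {𝕜 : Type*} [RCLike 𝕜] {γ φ : G → 𝕜} (hγ : Continuous γ)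
    (hγc : HasCompactSupport γ) (hφ : Continuous φ) :
    Continuous fun x => ∫ y, γ y * φ (y⁻¹ * x) ∂μ := by
  rw [← continuousOn_univ]
  refine continuousOn_integral_of_compact_support (k := tsupport γ) hγc
    (by fun_prop) fun x y _ hy => ?_
  rw [image_eq_zero_of_notMem_tsupport hy, zero_mul]

omit [LocallyCompactSpace G] [BorelSpace G] [μ.IsHaarMeasure] [μ.Regular] in
theorem hasCompactSupport_integral_mul_inv_mul [T2Space G] {𝕜 : Type*} [RCLike 𝕜] {γ φ : G → 𝕜}
    (hγc : HasCompactSupport γ) (hφc : HasCompactSupport φ) :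
    HasCompactSupport fun x => ∫ y, γ y * φ (y⁻¹ * x) ∂μ := by
  refine HasCompactSupport.intro (IsCompact.mul (s := tsupport γ) (t := tsupport φ) hγc hφc)
    fun x hx => ?_
  rw [integral_eq_zero_of_ae (Filter.Eventually.of_forall fun y => ?_)]
  by_contra h
  simp only [Pi.zero_apply, mul_eq_zero, not_or] at h
  exact hx ⟨y, subset_tsupport _ h.1, y⁻¹ * x, subset_tsupport _ h.2, by simp⟩

variable [T2Space G]

theorem integral_comp_inv_mul_of_hasCompactSupport {φ : G → ℝ} (hφ : Continuous φ)
    (hφc : HasCompactSupport φ) (x : G) :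
    ∫ y, φ (y⁻¹ * x) ∂μ = ∫ y, φ y * (modular y)⁻¹ ∂μ := by
  rw [← integral_comp_inv_of_hasCompactSupport μ hφ hφc,
    ← integral_mul_left_eq_self (fun y => φ (y⁻¹ * x)) x]
  simp

/-- The convolution `γ * φ` satisfies Minkowski's inequality with the weight `ω_q`. -/
theorem integral_conv_rpow_le {p q : ℝ} (hpq : p.HolderConjugate q) {γ φ : G → ℝ}
    (hγ : Continuous γ) (hγc : HasCompactSupport γ) (hγ0 : ∀ x, 0 ≤ γ x)
    (hφ : Continuous φ) (hφc : HasCompactSupport φ) (hφ0 : ∀ x, 0 ≤ φ x) :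
    ∫ x, (∫ y, γ y * φ (y⁻¹ * x) ∂μ) ^ p ∂μ ≤
      (∫ x, φ x * weight q x ∂μ) ^ p * ∫ x, γ x ^ p ∂μ := by
  set A := ∫ x, φ x * weight q x ∂μ with hA
  have hp := hpq.pos
  have hq := hpq.symm.pos
  have hpq1 : p⁻¹ + q⁻¹ = 1 := hpq.inv_add_inv_eq_one
  have hA0 : 0 ≤ A := integral_nonneg fun x => mul_nonneg (hφ0 x) (weight_pos q x).le
  have hΔ : Continuous fun x : G => modular x ^ p⁻¹ :=
    continuous_modular.rpow_const fun x => Or.inl (modular_pos x).ne'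
  have hω : Continuous (weight q : G → ℝ) := continuous_weight q
  -- The splitting `φ = u v` is chosen so that `u^p = φ ω_q` and `v^q = φ Δ^(1/p)`. Inversion
  -- multiplies the latter by `Δ⁻¹`, so its integral is also `∫ φ ω_q`; Hölder then gives the sharp
  -- constant.
  let u : G → ℝ := fun z => (φ z * weight q z) ^ p⁻¹
  let v : G → ℝ := fun z => (φ z * modular z ^ p⁻¹) ^ q⁻¹
  have hu : Continuous u := (hφ.mul hω).rpow_const fun _ => Or.inr (inv_nonneg.2 hp.le)
  have hv : Continuous v := (hφ.mul hΔ).rpow_const fun _ => Or.inr (inv_nonneg.2 hq.le)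
  have hu0 : ∀ z, 0 ≤ u z := fun z =>
    Real.rpow_nonneg (mul_nonneg (hφ0 z) (weight_pos q z).le) _
  have hv0 : ∀ z, 0 ≤ v z := fun z =>
    Real.rpow_nonneg (mul_nonneg (hφ0 z) (Real.rpow_nonneg (modular_pos z).le _)) _
  have huc : HasCompactSupport u := (hφc.mul_right (f' := weight q)).comp_left
    (g := fun t : ℝ => t ^ p⁻¹) (Real.zero_rpow (inv_ne_zero hp.ne'))
  have hvc : HasCompactSupport v := (hφc.mul_right (f' := fun z => modular z ^ p⁻¹)).comp_left
    (g := fun t : ℝ => t ^ q⁻¹) (Real.zero_rpow (inv_ne_zero hq.ne'))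
  have hup : ∀ z, u z ^ p = φ z * weight q z := fun z =>
    Real.rpow_inv_rpow (mul_nonneg (hφ0 z) (weight_pos q z).le) hp.ne'
  have hvq : ∀ z, v z ^ q = φ z * modular z ^ p⁻¹ := fun z =>
    Real.rpow_inv_rpow (mul_nonneg (hφ0 z) (Real.rpow_nonneg (modular_pos z).le _)) hq.ne'
  have huv : ∀ z, u z * v z = φ z := fun z => by
    have hm := modular_pos z
    simp only [u, v, weight]
    rw [Real.mul_rpow (hφ0 z) (Real.rpow_nonneg hm.le _),
      Real.mul_rpow (hφ0 z) (Real.rpow_nonneg hm.le _), mul_mul_mul_comm,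
      ← Real.rpow_add_of_nonneg (hφ0 z) (by positivity) (by positivity), hpq1, Real.rpow_one,
      ← Real.rpow_mul hm.le, ← Real.rpow_mul hm.le, ← Real.rpow_add hm]
    have : -(1 / q) * p⁻¹ + p⁻¹ * q⁻¹ = 0 := by rw [one_div]; ring
    rw [this, Real.rpow_zero, mul_one]
  have hvA : ∀ x, ∫ y, v (y⁻¹ * x) ^ q ∂μ = A := fun x => by
    simp only [hvq]
    rw [integral_comp_inv_mul_of_hasCompactSupport μ (φ := fun z => φ z * modular z ^ p⁻¹)
      (hφ.mul hΔ) hφc.mul_right x]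
    refine integral_congr_ae (Filter.Eventually.of_forall fun y => ?_)
    have hm := modular_pos y
    simp only [weight]
    rw [mul_assoc, ← Real.rpow_neg_one (modular y), ← Real.rpow_add hm]
    congr 2
    rw [one_div]
    linarith
  have hpt : ∀ x, (∫ y, γ y * φ (y⁻¹ * x) ∂μ) ^ p ≤
      (∫ y, γ y ^ p * (φ (y⁻¹ * x) * weight q (y⁻¹ * x)) ∂μ) * A ^ (p / q) := fun x => by
    have h1 := integral_mul_le_Lp_mul_Lq_of_nonneg (μ := μ) hpq
      (f := fun y => γ y * u (y⁻¹ * x)) (g := fun y => v (y⁻¹ * x))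
      (Filter.Eventually.of_forall fun y => mul_nonneg (hγ0 y) (hu0 _))
      (Filter.Eventually.of_forall fun y => hv0 _)
      (Continuous.memLp_of_hasCompactSupport (by fun_prop) hγc.mul_right)
      (Continuous.memLp_of_hasCompactSupport (by fun_prop) (hvc.comp_mul_right x).comp_inv)
    have h2 : ∀ y, γ y * u (y⁻¹ * x) * v (y⁻¹ * x) = γ y * φ (y⁻¹ * x) := fun y => by
      rw [mul_assoc, huv]
    have h3 : ∀ y, (γ y * u (y⁻¹ * x)) ^ p =
        γ y ^ p * (φ (y⁻¹ * x) * weight q (y⁻¹ * x)) := fun y => by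
      rw [Real.mul_rpow (hγ0 y) (hu0 _), hup]
    simp only [h2, h3, hvA] at h1
    have hI : 0 ≤ ∫ y, γ y ^ p * (φ (y⁻¹ * x) * weight q (y⁻¹ * x)) ∂μ :=
      integral_nonneg fun y => mul_nonneg (Real.rpow_nonneg (hγ0 y) _)
        (mul_nonneg (hφ0 _) (weight_pos q _).le)
    calc _ ≤ _ := Real.rpow_le_rpow (integral_nonneg fun y => mul_nonneg (hγ0 y) (hφ0 _)) h1 hp.le
      _ = _ := by
        rw [Real.mul_rpow (Real.rpow_nonneg hI _) (Real.rpow_nonneg hA0 _), one_div,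
          Real.rpow_inv_rpow hI hp.ne', ← Real.rpow_mul hA0]
        congr 2
        field_simp
  have hγp : Continuous fun y => γ y ^ p := hγ.rpow_const fun _ => Or.inr hp.le
  have hγpc : HasCompactSupport fun y => γ y ^ p :=
    hγc.comp_left (g := fun t : ℝ => t ^ p) (Real.zero_rpow hp.ne')
  have hφω : HasCompactSupport fun z => φ z * weight q z := hφc.mul_right
  have hswap : ∫ x, ∫ y, γ y ^ p * (φ (y⁻¹ * x) * weight q (y⁻¹ * x)) ∂μ ∂μ =
      (∫ y, γ y ^ p ∂μ) * A := by
    rw [integral_integral_swap_of_hasCompactSupport]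
    · rw [← integral_mul_const]
      refine integral_congr_ae (Filter.Eventually.of_forall fun y => ?_)
      simp only
      rw [integral_const_mul,
        integral_mul_left_eq_self (fun x => φ x * weight q x) y⁻¹]
    · exact (hγp.comp continuous_snd).mul ((hφ.mul hω).comp
        (by fun_prop : Continuous fun z : G × G => z.2⁻¹ * z.1))
    · have hK := (IsCompact.prod (s := tsupport fun y => γ y ^ p)
        (t := tsupport fun z => φ z * weight q z) hγpc hφω).image
        (show Continuous fun z : G × G => (z.1 * z.2, z.1) by fun_prop)
      refine HasCompactSupport.intro hK fun z hz => ?_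
      by_contra hne
      simp only [Function.uncurry, mul_eq_zero (a := γ z.2 ^ p), not_or] at hne
      exact hz ⟨(z.2, z.2⁻¹ * z.1), ⟨subset_tsupport _ hne.1,
        subset_tsupport (fun z => φ z * weight q z) hne.2⟩, by simp⟩
  have hcc := continuous_integral_mul_inv_mul μ hγ hγc hφ
  have hccs := hasCompactSupport_integral_mul_inv_mul μ hγc hφc
  have hdc := continuous_integral_mul_inv_mul μ hγp hγpc (hφ.mul hω)
  have hdcs := hasCompactSupport_integral_mul_inv_mul μ hγpc hφω
  calc _ ≤ ∫ x, (∫ y, γ y ^ p * (φ (y⁻¹ * x) * weight q (y⁻¹ * x)) ∂μ) * A ^ (p / q) ∂μ := by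
        refine integral_mono ?_ ?_ hpt
        · exact Continuous.integrable_of_hasCompactSupport (hcc.rpow_const fun _ => Or.inr hp.le)
            (hccs.comp_left (g := fun t : ℝ => t ^ p) (Real.zero_rpow hp.ne'))
        · exact (hdc.integrable_of_hasCompactSupport hdcs).mul_const _
    _ = (∫ y, γ y ^ p ∂μ) * (A * A ^ (p / q)) := by
        rw [integral_mul_const, hswap, mul_assoc]
    _ = _ := by
        rw [mul_comm]
        congr 1
        nth_rewrite 1 [← Real.rpow_one A]
        rw [← Real.rpow_add_of_nonneg hA0 zero_le_one (by positivity)]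
        congr 1
        have := congrArg (p * ·) hpq1
        simp only [mul_add, mul_inv_cancel₀ hp.ne', mul_one] at this
        rw [div_eq_mul_inv]
        exact this

theorem eLpNorm_conv_le {p q : ℝ} (hpq : p.HolderConjugate q) {γ φ : G → ℂ}
    (hγ : Continuous γ) (hγc : HasCompactSupport γ) (hφ : Continuous φ)
    (hφc : HasCompactSupport φ) :
    eLpNorm (fun x => ∫ y, ‖γ y * φ (y⁻¹ * x)‖ ∂μ) (ENNReal.ofReal p) μ ≤
      eLpNorm γ (ENNReal.ofReal p) μ * eLpNorm (fun x => φ x * (weight q x : ℂ)) 1 μ := by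
  have hp := hpq.pos
  have hp0 : ENNReal.ofReal p ≠ 0 := by simpa using hp
  have key := integral_conv_rpow_le μ hpq hγ.norm hγc.norm (fun x => norm_nonneg _)
    hφ.norm hφc.norm (fun x => norm_nonneg _)
  simp only [norm_mul]
  have m1 : MemLp (fun x => ∫ y, ‖γ y‖ * ‖φ (y⁻¹ * x)‖ ∂μ) (ENNReal.ofReal p) μ :=
    (continuous_integral_mul_inv_mul μ hγ.norm hγc.norm hφ.norm).memLp_of_hasCompactSupport
      (hasCompactSupport_integral_mul_inv_mul μ (γ := fun y => ‖γ y‖) (φ := fun y => ‖φ y‖)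
        hγc.norm hφc.norm)
  have m2 : MemLp (fun x => φ x * (weight q x : ℂ)) 1 μ :=
    (hφ.mul (Complex.continuous_ofReal.comp (continuous_weight q))).memLp_of_hasCompactSupport
      hφc.mul_right
  have n2 : ∀ x : G, ‖φ x * (weight q x : ℂ)‖ = ‖φ x‖ * weight q x := fun x => by
    rw [norm_mul, Complex.norm_real, Real.norm_of_nonneg (weight_pos q x).le]
  have n1 : ∀ x, ‖∫ y, ‖γ y‖ * ‖φ (y⁻¹ * x)‖ ∂μ‖ = ∫ y, ‖γ y‖ * ‖φ (y⁻¹ * x)‖ ∂μ := fun x =>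
    Real.norm_of_nonneg (integral_nonneg fun y => by positivity)
  have hA0 : 0 ≤ ∫ x, ‖φ x‖ * weight q x ∂μ :=
    integral_nonneg fun x => mul_nonneg (norm_nonneg _) (weight_pos q x).le
  rw [m1.eLpNorm_eq_integral_rpow_norm hp0 ENNReal.ofReal_ne_top,
    (hγ.memLp_of_hasCompactSupport hγc).eLpNorm_eq_integral_rpow_norm hp0 ENNReal.ofReal_ne_top,
    m2.eLpNorm_eq_integral_rpow_norm one_ne_zero ENNReal.one_ne_top,
    ENNReal.toReal_ofReal hp.le, ENNReal.toReal_one, ← ENNReal.ofReal_mul (by positivity)]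
  simp only [inv_one, Real.rpow_one, n2, n1]
  refine ENNReal.ofReal_le_ofReal ?_
  calc _ ≤ ((∫ x, ‖φ x‖ * weight q x ∂μ) ^ p * ∫ x, ‖γ x‖ ^ p ∂μ) ^ p⁻¹ :=
        Real.rpow_le_rpow (integral_nonneg fun x => Real.rpow_nonneg
          (integral_nonneg fun y => by positivity) _) key (by positivity)
    _ = _ := by
        rw [Real.mul_rpow (by positivity) (by positivity), Real.rpow_rpow_inv hA0 hp.ne', mul_comm]

omit [LocallyCompactSpace G] [μ.IsHaarMeasure] [μ.Regular] [T2Space G] [IsTopologicalGroup G]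
  [BorelSpace G] [TopologicalSpace G] [MeasurableSpace G] [Group G] in
theorem hasSum_mul_prod {ι κ : Type*} {a : ι → ℂ} {b : κ → ℂ} {s t : ℂ} (ha : HasSum a s)
    (hb : HasSum b t) : HasSum (fun i : ι × κ => a i.1 * b i.2) (s * t) :=
  ha.mul hb (summable_mul_of_summable_norm (summable_norm_iff.2 ha.summable)
    (summable_norm_iff.2 hb.summable))

/-- Expanding `g` and `f ω_q` in series of continuous compactly supported functions turns `g * f`
into a double series converging absolutely in `L^p`. The constants 5 come from these expansions;
only finiteness and uniformity in `g` matter. -/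
theorem exists_conv_bound {p q : ℝ} (hpq : p.HolderConjugate q) {f : G → ℂ}
    (hf : MemL1Weighted μ (weight q) f) :
    ∃ C : ℝ≥0∞, C ≠ ∞ ∧ ∀ g : G → ℂ, MemLp g (ENNReal.ofReal p) μ →
      ConvExists μ g f ∧ MemLp (conv μ g f) (ENNReal.ofReal p) μ ∧
      eLpNorm (conv μ g f) (ENNReal.ofReal p) μ ≤
        (eLpNorm g (ENNReal.ofReal p) μ + 5) * C := by
  have hp1 : 1 ≤ ENNReal.ofReal p := by simpa using hpq.lt.le
  have : Fact (1 ≤ ENNReal.ofReal p) := ⟨hp1⟩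
  have hω : ∀ x : G, (weight q x : ℂ) ≠ 0 := fun x => by exact_mod_cast (weight_pos q x).ne'
  have hωc : Continuous fun x : G => (weight q x : ℂ) :=
    Complex.continuous_ofReal.comp (continuous_weight q)
  have hf1 := memLp_one_iff_integrable.2 hf
  obtain ⟨ψ, hψ, hψc, hψs, hψf⟩ := exists_hasSum_continuous le_rfl ENNReal.one_ne_top hf1
  refine ⟨_, (ENNReal.add_lt_top.2 ⟨hf1.2, by simp⟩ : _ + 5 < ∞).ne, fun g hg => ?_⟩
  obtain ⟨γ, hγ, hγc, hγs, hγg⟩ := exists_hasSum_continuous hp1 ENNReal.ofReal_ne_top hg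
  let φ : ℕ → G → ℂ := fun m x => ψ m x * (weight q x : ℂ)⁻¹
  have hφ : ∀ m, Continuous (φ m) := fun m => (hψ m).mul (hωc.inv₀ hω)
  have hφc : ∀ m, HasCompactSupport (φ m) := fun m => (hψc m).mul_right
  have hφψ : ∀ m, (fun x => φ m x * (weight q x : ℂ)) = ψ m := fun m => by
    ext x; simp [φ, hω x]
  have hφf : ∀ᵐ x ∂μ, HasSum (fun m => φ m x) (f x) := hψf.mono fun x hx => by
    have := hx.mul_right (weight q x : ℂ)⁻¹
    rwa [mul_assoc, mul_inv_cancel₀ (hω x), mul_one] at this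
  let F : ℕ × ℕ → G → G → ℂ := fun i x y => γ i.1 y * φ i.2 (y⁻¹ * x)
  have hFint : ∀ i x, Integrable (F i x) μ := fun i x =>
    Continuous.integrable_of_hasCompactSupport ((hγ i.1).mul ((hφ i.2).comp (by fun_prop)))
      (hγc i.1).mul_right
  have hacont : ∀ i, Continuous fun x => ∫ y, ‖F i x y‖ ∂μ := fun i => by
    simp only [F, norm_mul]
    exact continuous_integral_mul_inv_mul μ (hγ i.1).norm (hγc i.1).norm (hφ i.2).norm
  have hccont : ∀ i, Continuous fun x => ∫ y, F i x y ∂μ := fun i =>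
    continuous_integral_mul_inv_mul μ (hγ i.1) (hγc i.1) (hφ i.2)
  have hsum : ∑' i, eLpNorm (fun x => ∫ y, ‖F i x y‖ ∂μ) (ENNReal.ofReal p) μ ≤
      (eLpNorm g (ENNReal.ofReal p) μ + 5) *
        (eLpNorm (fun x => f x * (weight q x : ℂ)) 1 μ + 5) := calc
    _ ≤ ∑' i : ℕ × ℕ, eLpNorm (γ i.1) (ENNReal.ofReal p) μ * eLpNorm (ψ i.2) 1 μ := by
      refine ENNReal.tsum_le_tsum fun i => ?_
      have := eLpNorm_conv_le μ hpq (hγ i.1) (hγc i.1) (hφ i.2) (hφc i.2)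
      rwa [hφψ] at this
    _ = (∑' n, eLpNorm (γ n) (ENNReal.ofReal p) μ) * ∑' m, eLpNorm (ψ m) 1 μ := by
      rw [ENNReal.tsum_prod
        (f := fun n m => eLpNorm (γ n) (ENNReal.ofReal p) μ * eLpNorm (ψ m) 1 μ)]
      simp only [ENNReal.tsum_mul_left, ENNReal.tsum_mul_right]
    _ ≤ _ := mul_le_mul' hγs hψs
  have hfin : (eLpNorm g (ENNReal.ofReal p) μ + 5) *
        (eLpNorm (fun x => f x * (weight q x : ℂ)) 1 μ + 5) < ∞ :=
    ENNReal.mul_lt_top (ENNReal.add_lt_top.2 ⟨hg.2, by simp⟩)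
      (ENNReal.add_lt_top.2 ⟨hf1.2, by simp⟩)
  have hae := summable_norm_of_tsum_eLpNorm_ne_top hp1
    (fun i => (hacont i).aestronglyMeasurable) (hsum.trans_lt hfin).ne
  have hxy : ∀ x, ∀ᵐ y ∂μ, HasSum (fun i => F i x y) (g y * f (y⁻¹ * x)) := fun x => by
    have h' : ∀ᵐ y ∂μ, HasSum (fun m => φ m (y⁻¹ * x)) (f (y⁻¹ * x)) :=
      (quasiMeasurePreserving_inv_mul μ x).ae hφf
    filter_upwards [hγg, h'] with y h1 h2
    exact hasSum_mul_prod (a := fun n => γ n y) (b := fun m => φ m (y⁻¹ * x)) h1 h2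
  have hconv : ∀ᵐ x ∂μ, Integrable (fun y => g y * f (y⁻¹ * x)) μ ∧
      HasSum (fun i => ∫ y, F i x y ∂μ) (conv μ g f x) := hae.mono fun x hx =>
    integrable_and_hasSum_integral (F := fun i => F i x) (h := fun y => g y * f (y⁻¹ * x))
      (fun i => hFint i x) hx.of_norm (hxy x)
  have hle : ∀ i, eLpNorm (fun x => ∫ y, F i x y ∂μ) (ENNReal.ofReal p) μ ≤
      eLpNorm (fun x => ∫ y, ‖F i x y‖ ∂μ) (ENNReal.ofReal p) μ := fun i =>
    eLpNorm_mono_real fun x => norm_integral_le_integral_norm (F i x)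
  have hcm : ∀ i, MemLp (fun x => ∫ y, F i x y ∂μ) (ENNReal.ofReal p) μ := fun i =>
    (hccont i).memLp_of_hasCompactSupport
      (hasCompactSupport_integral_mul_inv_mul μ (γ := γ i.1) (φ := φ i.2) (hγc i.1) (hφc i.2))
  have hsum' : ∑' i, ‖(hcm i).toLp‖ₑ ≤ (eLpNorm g (ENNReal.ofReal p) μ + 5) *
      (eLpNorm (fun x => f x * (weight q x : ℂ)) 1 μ + 5) := by
    simp only [Lp.enorm_toLp]
    exact (ENNReal.tsum_le_tsum hle).trans hsum
  -- Measurability of `g * f` also comes from this identification, not from Fubini.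
  have hLp : conv μ g f =ᵐ[μ] (∑' i, (hcm i).toLp : Lp ℂ (ENNReal.ofReal p) μ) := by
    filter_upwards [hconv, Lp.hasSum_coeFn_tsum (hsum'.trans_lt hfin).ne,
      ae_all_iff.2 fun i => (hcm i).coeFn_toLp] with x h1 h2 h3
    simp only [h3] at h2
    exact h1.2.unique h2
  refine ⟨hconv.mono fun x hx => hx.1, (memLp_congr_ae hLp).2 (Lp.memLp _), ?_⟩
  rw [eLpNorm_congr_ae hLp, ← Lp.enorm_def]
  exact enorm_tsum_le_tsum_enorm.trans hsum'

theorem isLTp_of_memL1Weighted {p q : ℝ} (hpq : p.HolderConjugate q) {f : G → ℂ}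
    (hf : MemL1Weighted μ (weight q) f) (hfp : MemLp f (ENNReal.ofReal p) μ) : IsLTp μ p f := by
  obtain ⟨C, hC, h⟩ := exists_conv_bound μ hpq hf
  refine ⟨hfp, fun g hg => (h g hg).1, fun g hg => (h g hg).2.1, ?_⟩
  refine lt_of_le_of_lt (iSup₂_le fun g hg => iSup_le fun hg1 => ((h g hg).2.2).trans ?_)
    (ENNReal.mul_lt_top (a := 1 + 5) (by simp) hC.lt_top)
  gcongr

end Minkowski

/-! ### Invariant means and averages of continuous functions. -/

section Mean

open scoped CompactlySupported

variable {G : Type*} [Group G] [TopologicalSpace G] [IsTopologicalGroup G]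
  [MeasurableSpace G] [BorelSpace G] {μ : Measure G} [μ.IsHaarMeasure]

/-- A left invariant mean on `L^∞(G)`. -/
structure IsLeftInvariantMean (m : Lp ℝ ∞ μ →ₗ[ℝ] ℝ) : Prop where
  nonneg : ∀ F : Lp ℝ ∞ μ, 0 ≤ F → 0 ≤ m F
  one : m ((memLp_top_const (1 : ℝ)).toLp (fun _ : G => (1 : ℝ))) = 1
  left_invariant : ∀ (x : G) (F : Lp ℝ ∞ μ),
    m (Lp.compMeasurePreserving (fun y => x * y) (measurePreserving_mul_left μ x) F) = m F

open Classical in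
/-- The value of a linear functional on `L^∞` at an essentially bounded function. -/
noncomputable def mean (m : Lp ℝ ∞ μ →ₗ[ℝ] ℝ) (F : G → ℝ) : ℝ :=
  if h : MemLp F ∞ μ then m (h.toLp F) else 0

variable {m : Lp ℝ ∞ μ →ₗ[ℝ] ℝ}

omit [IsTopologicalGroup G] [BorelSpace G] [μ.IsHaarMeasure] [TopologicalSpace G] [Group G]

theorem mean_of_memLp {F : G → ℝ} (h : MemLp F ∞ μ) : mean m F = m (h.toLp F) :=
  dif_pos h

theorem mean_add {F F' : G → ℝ} (h : MemLp F ∞ μ) (h' : MemLp F' ∞ μ) :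
    mean m (fun x => F x + F' x) = mean m F + mean m F' := by
  rw [mean_of_memLp h, mean_of_memLp h', ← map_add, ← MemLp.toLp_add h h']
  exact mean_of_memLp (h.add h')

theorem mean_const_mul {F : G → ℝ} (c : ℝ) (h : MemLp F ∞ μ) :
    mean m (fun x => c * F x) = c * mean m F := by
  rw [mean_of_memLp h, ← smul_eq_mul (a := c), ← map_smul, ← MemLp.toLp_const_smul c h]
  exact mean_of_memLp (h.const_smul c)

theorem mean_sub {F F' : G → ℝ} (h : MemLp F ∞ μ) (h' : MemLp F' ∞ μ) :
    mean m (fun x => F x - F' x) = mean m F - mean m F' := by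
  rw [mean_of_memLp h, mean_of_memLp h', ← map_sub, ← MemLp.toLp_sub h h']
  exact mean_of_memLp (h.sub h')

theorem mean_sum {ι : Type*} (s : Finset ι) {F : ι → G → ℝ} (h : ∀ i, MemLp (F i) ∞ μ) :
    mean m (fun x => ∑ i ∈ s, F i x) = ∑ i ∈ s, mean m (F i) := by
  classical
  induction s using Finset.induction_on with
  | empty => simpa using mean_const_mul (m := m) 0 (MemLp.zero (p := ∞) (μ := μ) (ε := ℝ))
  | insert i s hi ih =>
    simp only [Finset.sum_insert hi]
    rw [mean_add (h i) (memLp_finsetSum s fun i _ => h i), ih]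

section
variable [Group G] [TopologicalSpace G] [IsTopologicalGroup G] [BorelSpace G] [μ.IsHaarMeasure]

theorem IsLeftInvariantMean.mean_nonneg (hm : IsLeftInvariantMean m) {F : G → ℝ}
    (h : ∀ x, 0 ≤ F x) : 0 ≤ mean m F := by
  by_cases hF : MemLp F ∞ μ
  · rw [mean_of_memLp hF]
    refine hm.nonneg _ ((Lp.coeFn_nonneg _).1 ?_)
    filter_upwards [hF.coeFn_toLp] with x hx
    rw [hx]
    exact h x
  -- Outside `L^∞` the default value of `mean` is 0.
  · rw [mean, dif_neg hF]

theorem IsLeftInvariantMean.mean_const (hm : IsLeftInvariantMean m) (c : ℝ) :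
    mean m (fun _ => c) = c := by
  have := mean_const_mul (m := m) c (memLp_top_const (1 : ℝ))
  rwa [mean_of_memLp (memLp_top_const (1 : ℝ)), hm.one, mul_one] at this

theorem IsLeftInvariantMean.mean_mul_left (hm : IsLeftInvariantMean m) {F : G → ℝ}
    (h : MemLp F ∞ μ) (a : G) : mean m (fun x => F (a * x)) = mean m F := by
  rw [mean_of_memLp h, ← hm.left_invariant a (h.toLp F)]
  have h' := h.comp_measurePreserving (measurePreserving_mul_left μ a)
  exact mean_of_memLp h'

end

variable [Group G] [TopologicalSpace G] [IsTopologicalGroup G] [BorelSpace G]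

omit [Group G] [IsTopologicalGroup G] in
theorem memLp_top_of_continuous {F : G → ℝ} (hF : Continuous F) {B : ℝ} (hB : ∀ x, |F x| ≤ B) :
    MemLp F ∞ μ :=
  memLp_top_of_bound hF.aestronglyMeasurable B (Filter.Eventually.of_forall hB)

variable [μ.IsHaarMeasure]

omit [IsTopologicalGroup G] in
theorem memLp_top_integral_mul {φ F : G → ℝ} (hφ : Continuous φ) (hφc : HasCompactSupport φ)
    (hF : Continuous F) {B : ℝ} (hB : ∀ x, |F x| ≤ B) {θ : G → G → G}
    (hθ : Continuous fun z : G × G => θ z.1 z.2) :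
    MemLp (fun x => ∫ y, φ y * F (θ x y) ∂μ) ∞ μ := by
  refine memLp_top_of_continuous ?_ (μ := μ) (B := ∫ y, |φ y| * B ∂μ) fun x => ?_
  · rw [← continuousOn_univ]
    refine continuousOn_integral_of_compact_support (k := tsupport φ) hφc
      ((hφ.comp continuous_snd).mul (hF.comp hθ)).continuousOn fun x y _ hy => ?_
    rw [image_eq_zero_of_notMem_tsupport hy, zero_mul]
  · have hi : Integrable (fun y => |φ y| * B) μ :=
      (hφ.abs.integrable_of_hasCompactSupport hφc.norm).mul_const B
    rw [← Real.norm_eq_abs]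
    refine norm_integral_le_of_norm_le hi ?_
    refine Filter.Eventually.of_forall fun y => ?_
    rw [norm_mul]
    exact mul_le_mul_of_nonneg_left (hB _) (norm_nonneg _)

variable [T2Space G] [LocallyCompactSpace G]

/-- Averages of a nonnegative function against a left invariant mean define a Haar integral. -/
theorem IsLeftInvariantMean.exists_mean_inv_mul_eq (hm : IsLeftInvariantMean m) {F : G → ℝ}
    (hF : Continuous F) {B : ℝ} (hB : ∀ x, |F x| ≤ B) (hF0 : ∀ x, 0 ≤ F x) :
    ∃ c : ℝ, ∀ φ : G → ℝ, Continuous φ → HasCompactSupport φ →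
      mean m (fun x => ∫ y, φ y * F (y⁻¹ * x) ∂μ) = c * ∫ y, φ y ∂μ := by
  have hmem : ∀ φ : G → ℝ, Continuous φ → HasCompactSupport φ →
      MemLp (fun x => ∫ y, φ y * F (y⁻¹ * x) ∂μ) ∞ μ := fun φ h1 h2 =>
    memLp_top_integral_mul h1 h2 hF hB (θ := fun x y => y⁻¹ * x) (by fun_prop)
  have hint : ∀ φ : G → ℝ, Continuous φ → HasCompactSupport φ → ∀ x,
      Integrable (fun y => φ y * F (y⁻¹ * x)) μ := fun φ h1 h2 x =>
    Continuous.integrable_of_hasCompactSupport (h1.mul (hF.comp (by fun_prop))) h2.mul_right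
  let Λ₀ : C_c(G, ℝ) →ₗ[ℝ] ℝ :=
    { toFun := fun φ => mean m (fun x => ∫ y, φ y * F (y⁻¹ * x) ∂μ)
      map_add' := fun φ ψ => by
        rw [← mean_add (hmem φ (map_continuous φ) φ.hasCompactSupport)
          (hmem ψ (map_continuous ψ) ψ.hasCompactSupport)]
        congr 1 with x
        rw [← integral_add (hint φ (map_continuous φ) φ.hasCompactSupport x)
          (hint ψ (map_continuous ψ) ψ.hasCompactSupport x)]
        simp only [CompactlySupportedContinuousMap.coe_add, Pi.add_apply, add_mul]
      map_smul' := fun c φ => by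
        rw [RingHom.id_apply, smul_eq_mul,
          ← mean_const_mul c (hmem φ (map_continuous φ) φ.hasCompactSupport)]
        congr 1 with x
        rw [← integral_const_mul]
        simp only [CompactlySupportedContinuousMap.coe_smul, Pi.smul_apply, smul_eq_mul,
          mul_assoc] }
  let Λ : C_c(G, ℝ) →ₚ[ℝ] ℝ := PositiveLinearMap.mk₀ Λ₀ fun φ hφ =>
    hm.mean_nonneg fun x => integral_nonneg fun y => mul_nonneg (hφ y) (hF0 _)
  -- Translating `φ` translates the averaged function, which the mean ignores. So `ν` is left
  -- invariant, and uniqueness of Haar measure provides `c`.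
  let ν := RealRMK.rieszMeasure Λ
  have hν : ∀ φ : C_c(G, ℝ),
      ∫ x, φ x ∂ν = mean m (fun x => ∫ y, φ y * F (y⁻¹ * x) ∂μ) := fun φ =>
    RealRMK.integral_rieszMeasure Λ φ
  have hinv : ν.IsMulLeftInvariant := ⟨fun a => by
    have hreg : (Measure.map (a * ·) ν).Regular := Measure.Regular.map (Homeomorph.mulLeft a)
    refine Measure.ext_of_integral_eq_on_compactlySupported fun φ => ?_
    have h1 : ∫ x, φ x ∂(Measure.map (a * ·) ν) = ∫ x, φ (a * x) ∂ν :=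
      integral_map_equiv (Homeomorph.mulLeft a).toMeasurableEquiv φ
    let φa : C_c(G, ℝ) := ⟨⟨fun x => φ (a * x), φ.continuous.comp (continuous_const_mul a)⟩,
      φ.hasCompactSupport.comp_mul_left a⟩
    rw [h1]
    refine (hν φa).trans ?_
    rw [hν φ, ← hm.mean_mul_left (hmem φ (map_continuous φ) φ.hasCompactSupport) a]
    congr 1 with x
    rw [← integral_mul_left_eq_self (fun y => φ y * F (y⁻¹ * (a * x))) a]
    refine integral_congr_ae (Filter.Eventually.of_forall fun y => ?_)
    simp [φa, mul_assoc]⟩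
  refine ⟨Measure.haarScalarFactor ν μ, fun φ hφ hφc => ?_⟩
  have h := hν ⟨⟨φ, hφ⟩, hφc⟩
  have h2 := Measure.integral_isMulLeftInvariant_eq_smul_of_hasCompactSupport ν μ hφ hφc
  rw [integral_smul_nnreal_measure] at h2
  exact (h.symm.trans h2 : _)

/-- Adding `B` makes `F` nonnegative, and replacing `φ` by `φ(y⁻¹) Δ(y)⁻¹`, which has the same
integral, turns `F(y⁻¹ x)` into `F(y x)`. -/
theorem IsLeftInvariantMean.exists_mean_mul_eq [μ.Regular] (hm : IsLeftInvariantMean m) {F : G → ℝ}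
    (hF : Continuous F) {B : ℝ} (hB : ∀ x, |F x| ≤ B) :
    ∃ c : ℝ, ∀ φ : G → ℝ, Continuous φ → HasCompactSupport φ →
      mean m (fun x => ∫ y, φ y * F (y * x) ∂μ) = c * ∫ y, φ y ∂μ := by
  have hB' : ∀ x, |F x + B| ≤ 2 * B := fun x => by
    have := abs_le.1 (hB x)
    rw [abs_le]
    constructor <;> linarith
  obtain ⟨c, hc⟩ := hm.exists_mean_inv_mul_eq (F := fun x => F x + B) (by fun_prop) hB'
    fun x => by linarith [(abs_le.1 (hB x)).1]
  have hΔ : Continuous fun y : G => (modular y)⁻¹ :=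
    continuous_modular.inv₀ fun y => (modular_pos y).ne'
  refine ⟨c - B, fun φ hφ hφc => ?_⟩
  have e1 : ∀ x, ∫ y, (φ y⁻¹ * (modular y)⁻¹) * (F (y⁻¹ * x) + B) ∂μ =
      (∫ y, φ y * F (y * x) ∂μ) + B * ∫ y, φ y ∂μ := fun x => by
    have h := integral_comp_inv_of_hasCompactSupport μ
      (φ := fun y => φ y⁻¹ * (F (y⁻¹ * x) + B)) (by fun_prop) hφc.comp_inv.mul_right
    simp only [inv_inv] at h
    calc _ = ∫ y, φ y⁻¹ * (F (y⁻¹ * x) + B) * (modular y)⁻¹ ∂μ :=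
          integral_congr_ae (Filter.Eventually.of_forall fun y => by simp only; ring)
      _ = ∫ y, φ y * (F (y * x) + B) ∂μ := h.symm
      _ = ∫ y, (φ y * F (y * x) + B * φ y) ∂μ :=
          integral_congr_ae (Filter.Eventually.of_forall fun y => by simp only; ring)
      _ = _ := by
        rw [integral_add, integral_const_mul]
        · exact Continuous.integrable_of_hasCompactSupport (by fun_prop) hφc.mul_right
        · exact Continuous.integrable_of_hasCompactSupport (by fun_prop) hφc.mul_left
  have e2 : ∫ y, φ y⁻¹ * (modular y)⁻¹ ∂μ = ∫ y, φ y ∂μ := by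
    have h := integral_comp_inv_of_hasCompactSupport μ (φ := fun y => φ y⁻¹) (by fun_prop)
      hφc.comp_inv
    simpa only [inv_inv] using h.symm
  have h := hc (fun y => φ y⁻¹ * (modular y)⁻¹) (by fun_prop) hφc.comp_inv.mul_right
  simp only [e1, e2] at h
  rw [mean_add (memLp_top_integral_mul hφ hφc hF hB (θ := fun x y => y * x) (by fun_prop))
    (memLp_top_const _), hm.mean_const] at h
  linarith

end Mean

/-! ### Integrals and norms in `L^1`. -/

section L1

variable {α : Type*} [MeasurableSpace α] {μ : Measure α}

theorem integralCLM_apply (u : Lp ℝ 1 μ) :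
    (L1.integralCLM (E := ℝ) (μ := μ)) u = ∫ t, u t ∂μ := by
  rw [← L1.integral_eq_integral, L1.integral_eq]

theorem norm_sub_toLp {f g : α → ℝ} (hf : MemLp f 1 μ) (hg : MemLp g 1 μ) :
    ‖hf.toLp - hg.toLp‖ = ∫ t, |f t - g t| ∂μ := by
  rw [L1.norm_eq_integral_norm]
  refine integral_congr_ae ?_
  filter_upwards [Lp.coeFn_sub hf.toLp hg.toLp, hf.coeFn_toLp, hg.coeFn_toLp] with t h1 h2 h3
  rw [h1, Pi.sub_apply, h2, h3, Real.norm_eq_abs]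

end L1

/-! ### Reiter's condition from an invariant mean. -/

section Reiter

variable {G : Type*} [Group G] [TopologicalSpace G] [IsTopologicalGroup G]
  [MeasurableSpace G] [BorelSpace G] (μ : Measure G) [μ.IsHaarMeasure]

/-- Left translation on `L^1(G)`: `(translate x u)(t) = u(x⁻¹ t)`. -/
noncomputable def translate (x : G) : Lp ℝ 1 μ →ₗᵢ[ℝ] Lp ℝ 1 μ :=
  Lp.compMeasurePreservingₗᵢ ℝ (fun t => x⁻¹ * t) (measurePreserving_mul_left μ x⁻¹)

theorem translate_mul (x y : G) (u : Lp ℝ 1 μ) :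
    translate μ (x * y) u = translate μ x (translate μ y u) := by
  have h := Lp.compMeasurePreserving_comp_apply u (measurePreserving_mul_left μ y⁻¹)
    (measurePreserving_mul_left μ x⁻¹)
  refine Eq.trans ?_ h
  change Lp.compMeasurePreserving _ _ u = _
  congr 1
  simp only [Function.comp_def, mul_inv_rev, mul_assoc]

theorem coeFn_translate (x : G) (u : Lp ℝ 1 μ) :
    translate μ x u =ᵐ[μ] fun t => u (x⁻¹ * t) :=
  Lp.coeFn_compMeasurePreserving u (measurePreserving_mul_left μ x⁻¹)

theorem integral_translate (x : G) (u : Lp ℝ 1 μ) :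
    ∫ t, translate μ x u t ∂μ = ∫ t, u t ∂μ := by
  rw [integral_congr_ae (coeFn_translate μ x u)]
  exact integral_mul_left_eq_self _ _

variable [LocallyCompactSpace G] [μ.Regular]

theorem continuous_translate (u : Lp ℝ 1 μ) : Continuous fun x => translate μ x u := by
  let g : C(G, C(G, G)) := (ContinuousMap.mk (fun z : G × G => z.1⁻¹ * z.2) (by fun_prop)).curry
  exact (continuous_const (y := u)).compMeasurePreservingLp g.continuous
    (fun x => measurePreserving_mul_left μ x⁻¹) ENNReal.one_ne_top

variable {μ}

theorem integrable_smul_translate {φ : G → ℝ} (hφ : Continuous φ) (hφc : HasCompactSupport φ)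
    (u : Lp ℝ 1 μ) : Integrable (fun y => φ y • translate μ y u) μ :=
  (hφ.smul (continuous_translate μ u)).integrable_of_hasCompactSupport hφc.smul_right

/-- The operator of convolution by a continuous compactly supported function on `L^1(G)`. -/
noncomputable def convOp {φ : G → ℝ} (hφ : Continuous φ) (hφc : HasCompactSupport φ) :
    Lp ℝ 1 μ →ₗ[ℝ] Lp ℝ 1 μ where
  toFun u := ∫ y, φ y • translate μ y u ∂μ
  map_add' u v := by
    rw [← integral_add (integrable_smul_translate hφ hφc u) (integrable_smul_translate hφ hφc v)]
    simp only [map_add, smul_add]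
  map_smul' c u := by
    rw [RingHom.id_apply, ← integral_smul]
    simp only [map_smul, smul_comm c]

theorem convOp_apply {φ : G → ℝ} (hφ : Continuous φ) (hφc : HasCompactSupport φ) (u : Lp ℝ 1 μ) :
    convOp hφ hφc u = ∫ y, φ y • translate μ y u ∂μ := rfl

theorem apply_convOp {φ : G → ℝ} (hφ : Continuous φ) (hφc : HasCompactSupport φ)
    (Λ : Lp ℝ 1 μ →L[ℝ] ℝ) (u : Lp ℝ 1 μ) :
    Λ (convOp hφ hφc u) = ∫ y, φ y * Λ (translate μ y u) ∂μ := by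
  rw [convOp_apply, ← Λ.integral_comp_comm (integrable_smul_translate hφ hφc u)]
  simp only [map_smul, smul_eq_mul]

theorem translate_convOp {φ : G → ℝ} (hφ : Continuous φ) (hφc : HasCompactSupport φ) (z : G)
    (u : Lp ℝ 1 μ) : translate μ z (convOp hφ hφc u) =
      convOp (φ := fun y => φ (z⁻¹ * y)) (by fun_prop) (hφc.comp_mul_left z⁻¹) u := by
  have h := (translate μ z).toContinuousLinearMap.integral_comp_comm
    (integrable_smul_translate hφ hφc u)
  rw [convOp_apply, convOp_apply]
  refine h.symm.trans ?_
  rw [← integral_mul_left_eq_self (fun y => φ (z⁻¹ * y) • translate μ y u) z]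
  refine integral_congr_ae (Filter.Eventually.of_forall fun y => ?_)
  simp only [inv_mul_cancel_left, translate_mul]
  exact map_smul (translate μ z) _ _

theorem norm_convOp_sub_le {φ ψ : G → ℝ} (hφ : Continuous φ) (hφc : HasCompactSupport φ)
    (hψ : Continuous ψ) (hψc : HasCompactSupport ψ) (u : Lp ℝ 1 μ) :
    ‖convOp hφ hφc u - convOp hψ hψc u‖ ≤ (∫ y, |φ y - ψ y| ∂μ) * ‖u‖ := by
  rw [convOp_apply, convOp_apply, ← integral_sub (integrable_smul_translate hφ hφc u)
    (integrable_smul_translate hψ hψc u), ← integral_mul_const]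
  refine norm_integral_le_of_norm_le ?_ (Filter.Eventually.of_forall fun y => ?_)
  · exact ((hφ.sub hψ).abs.integrable_of_hasCompactSupport (hφc.sub hψc).norm).mul_const _
  · rw [← sub_smul, norm_smul, LinearIsometry.norm_map, Real.norm_eq_abs]

theorem integral_convOp {φ : G → ℝ} (hφ : Continuous φ) (hφc : HasCompactSupport φ)
    (u : Lp ℝ 1 μ) : ∫ t, convOp hφ hφc u t ∂μ = (∫ y, φ y ∂μ) * ∫ t, u t ∂μ := by
  rw [← integralCLM_apply, apply_convOp hφ hφc]
  simp only [integralCLM_apply, integral_translate, integral_mul_const]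

variable [T2Space G]

/-- Day's convexity argument: convolutions by translates of `φ` almost agree on some `u`. -/
theorem IsLeftInvariantMean.exists_convOp_sub_lt {m : Lp ℝ ∞ μ →ₗ[ℝ] ℝ}
    (hm : IsLeftInvariantMean m) {φ : G → ℝ} (hφ : Continuous φ) (hφc : HasCompactSupport φ)
    (t : Finset G) (u₀ : Lp ℝ 1 μ) {ε : ℝ} (hε : 0 < ε) :
    ∃ u : Lp ℝ 1 μ, ∫ s, u s ∂μ = ∫ s, u₀ s ∂μ ∧ ‖u‖ ≤ ‖u₀‖ ∧
      ∀ z ∈ t, ‖translate μ z (convOp hφ hφc u) - convOp hφ hφc u‖ < ε := by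
  let S : Lp ℝ 1 μ →ₗ[ℝ] (t → Lp ℝ 1 μ) := LinearMap.pi fun j =>
    (translate μ j.1).toLinearMap ∘ₗ convOp hφ hφc - convOp hφ hφc
  -- This convex set contains every left translate of `u₀`. If `S '' C` misses a ball around 0, a
  -- separating functional is at least some `s > 0` at the images of all these translates.
  let C : Set (Lp ℝ 1 μ) :=
    {u | L1.integralCLM (E := ℝ) (μ := μ) u = ∫ s, u₀ s ∂μ} ∩ Metric.closedBall 0 ‖u₀‖
  have hC : Convex ℝ C := by
    refine Convex.inter (fun u hu v hv a b _ _ hab => ?_) (convex_closedBall _ _)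
    simp only [Set.mem_ofPred_eq] at hu hv ⊢
    rw [map_add, map_smul, map_smul, hu, hv, ← add_smul, hab, one_smul]
  classical
  by_contra hcon
  push Not at hcon
  have hdisj : Disjoint (Metric.ball (0 : t → Lp ℝ 1 μ) ε) (S '' C) := by
    rw [Set.disjoint_left]
    rintro _ hv ⟨u, hu, rfl⟩
    obtain ⟨z, hz, hle⟩ := hcon u (by rw [← integralCLM_apply]; exact hu.1)
      (mem_closedBall_zero_iff.1 hu.2)
    exact (hle.trans (norm_le_pi_norm (S u) ⟨z, hz⟩)).not_gt (mem_ball_zero_iff.1 hv)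
  obtain ⟨f, s, hf1, hf2⟩ := geometric_hahn_banach_open (convex_ball _ _) Metric.isOpen_ball
    (hC.linear_image S) hdisj
  have hs : 0 < s := by simpa using hf1 0 (Metric.mem_ball_self hε)
  let Λ : t → Lp ℝ 1 μ →L[ℝ] ℝ := fun j =>
    f.comp (ContinuousLinearMap.single ℝ (fun _ : t => Lp ℝ 1 μ) j)
  let F : t → G → ℝ := fun j x => Λ j (translate μ x u₀)
  have hF : ∀ j, Continuous (F j) := fun j => (Λ j).continuous.comp (continuous_translate μ u₀)
  have hB : ∀ j x, |F j x| ≤ ‖Λ j‖ * ‖u₀‖ := fun j x => by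
    simpa using (Λ j).le_opNorm (translate μ x u₀)
  let ψ : t → G → ℝ := fun j y => φ (j.1⁻¹ * y)
  have hψ : ∀ j, Continuous (ψ j) := fun j => by fun_prop
  have hψc : ∀ j, HasCompactSupport (ψ j) := fun j => hφc.comp_mul_left _
  have hmem : ∀ j (θ : G → ℝ), Continuous θ → HasCompactSupport θ →
      MemLp (fun x => ∫ y, θ y * F j (y * x) ∂μ) ∞ μ := fun j θ h1 h2 =>
    memLp_top_integral_mul h1 h2 (hF j) (hB j) (θ := fun x y => y * x) (by fun_prop)
  have hfS : ∀ x, f (S (translate μ x u₀)) =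
      ∑ j, ((∫ y, ψ j y * F j (y * x) ∂μ) - ∫ y, φ y * F j (y * x) ∂μ) := fun x => by
    have h1 : f (S (translate μ x u₀)) = ∑ j, Λ j (S (translate μ x u₀) j) := by
      conv_lhs => rw [← Finset.univ_sum_single (S (translate μ x u₀)), map_sum]
      rfl
    rw [h1]
    refine Finset.sum_congr rfl fun j _ => ?_
    have h2 : S (translate μ x u₀) j = translate μ j.1 (convOp hφ hφc (translate μ x u₀)) -
      convOp hφ hφc (translate μ x u₀) := rfl
    rw [h2, map_sub, translate_convOp, apply_convOp, apply_convOp]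
    simp only [F, ψ, translate_mul]
  let D : t → G → ℝ := fun j x => (∫ y, ψ j y * F j (y * x) ∂μ) - ∫ y, φ y * F j (y * x) ∂μ
  have hD : ∀ j, MemLp (D j) ∞ μ := fun j => (hmem j _ (hψ j) (hψc j)).sub (hmem j _ hφ hφc)
  -- Both averages have mean `c` times the integral of their kernel, and `ψ j` is a left translate
  -- of `φ`. So the mean of a function bounded below by `s` is zero.
  have hD0 : ∀ j, mean m (D j) = 0 := fun j => by
    obtain ⟨c, hc⟩ := hm.exists_mean_mul_eq (hF j) (hB j)
    simp only [D]
    rw [mean_sub (hmem j _ (hψ j) (hψc j)) (hmem j _ hφ hφc), hc _ (hψ j) (hψc j), hc _ hφ hφc,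
      integral_mul_left_eq_self φ, sub_self]
  have hle : ∀ x, 0 ≤ (∑ j, D j x) - s := fun x => by
    rw [← hfS, sub_nonneg]
    refine hf2 _ ⟨_, ⟨?_, ?_⟩, rfl⟩
    · rw [Set.mem_ofPred_eq, integralCLM_apply, integral_translate]
    · rw [mem_closedBall_zero_iff, LinearIsometry.norm_map]
  have h0 := hm.mean_nonneg hle
  rw [mean_sub (memLp_finsetSum _ fun j _ => hD j) (memLp_top_const s), hm.mean_const,
    mean_sum _ hD] at h0
  simp only [hD0, Finset.sum_const_zero] at h0
  linarith

/-- Reiter's condition in `L^1(G)`. -/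
theorem IsLeftInvariantMean.exists_norm_translate_sub_le {m : Lp ℝ ∞ μ →ₗ[ℝ] ℝ}
    (hm : IsLeftInvariantMean m) {K : Set G} (hK : IsCompact K) {ε : ℝ} (hε : 0 < ε) :
    ∃ v : Lp ℝ 1 μ, ∫ s, v s ∂μ = 1 ∧ ∀ z ∈ K, ‖translate μ z v - v‖ ≤ ε := by
  obtain ⟨⟨k, hk⟩, hkc, hk0, hk1⟩ := exists_continuous_nonneg_pos (1 : G)
  have hpos : 0 < ∫ x, k x ∂μ := hk.integral_pos_of_hasCompactSupport_nonneg_nonzero hkc hk0 hk1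
  let φ : G → ℝ := fun x => (∫ x, k x ∂μ)⁻¹ * k x
  have hφ : Continuous φ := by fun_prop
  have hφc : HasCompactSupport φ := HasCompactSupport.mul_left hkc
  have hφ1 : ∫ x, φ x ∂μ = 1 := by
    rw [integral_const_mul, inv_mul_cancel₀ hpos.ne']
  have hφm : MemLp φ 1 μ := hφ.memLp_of_hasCompactSupport hφc
  let u₀ : Lp ℝ 1 μ := hφm.toLp
  -- The shift from `z` to a nearby centre `w` acts on the kernel alone and costs at most `δ ‖u‖ ≤ ε
  -- / 2`, whatever `u` is. Hence a finite set of centres suffices for `K`.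
  let δ : ℝ := ε / (2 * (‖u₀‖ + 1))
  have hδ : 0 < δ := by positivity
  obtain ⟨t, -, ht⟩ := hK.elim_nhds_subcover
    (fun z => {x | ‖translate μ x u₀ - translate μ z u₀‖ < δ}) fun z _ => by
      have hcont : Continuous fun x => ‖translate μ x u₀ - translate μ z u₀‖ :=
        ((continuous_translate μ u₀).sub continuous_const).norm
      exact (isOpen_lt hcont continuous_const).mem_nhds (by simpa using hδ)
  obtain ⟨u, hu1, hu2, hu3⟩ := hm.exists_convOp_sub_lt hφ hφc t u₀ (half_pos hε)
  have hu₀ : ∫ s, u₀ s ∂μ = 1 := by rw [integral_congr_ae hφm.coeFn_toLp, hφ1]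
  refine ⟨convOp hφ hφc u, by rw [integral_convOp, hφ1, hu1, hu₀, one_mul], fun z hz => ?_⟩
  obtain ⟨w, hw, hzw⟩ := Set.mem_iUnion₂.1 (ht hz)
  have h1 : ‖translate μ z (convOp hφ hφc u) - translate μ w (convOp hφ hφc u)‖ ≤ ε / 2 := by
    rw [translate_convOp, translate_convOp]
    refine (norm_convOp_sub_le _ _ _ _ u).trans ?_
    have h2 : ∫ y, |φ (z⁻¹ * y) - φ (w⁻¹ * y)| ∂μ < δ := by
      exact lt_of_eq_of_lt
        (norm_sub_toLp (hφm.comp_measurePreserving (measurePreserving_mul_left μ z⁻¹))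
          (hφm.comp_measurePreserving (measurePreserving_mul_left μ w⁻¹))).symm hzw
    calc _ ≤ δ * (‖u₀‖ + 1) := by
          gcongr
          linarith
      _ = ε / 2 := by
          simp only [δ]
          have : ‖u₀‖ + 1 ≠ 0 := by positivity
          field_simp
  calc _ = ‖(translate μ z (convOp hφ hφc u) - translate μ w (convOp hφ hφc u)) +
        (translate μ w (convOp hφ hφc u) - convOp hφ hφc u)‖ := by rw [sub_add_sub_cancel]
    _ ≤ ε / 2 + ε / 2 := (norm_add_le _ _).trans (add_le_add h1 (hu3 w hw).le)
    _ = ε := add_halves ε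

/-- A form of Reiter's condition with continuous compactly supported functions. -/
theorem IsLeftInvariantMean.exists_integral_min_ge {m : Lp ℝ ∞ μ →ₗ[ℝ] ℝ}
    (hm : IsLeftInvariantMean m) {K : Set G} (hK : IsCompact K) :
    ∃ H : G → ℝ, Continuous H ∧ HasCompactSupport H ∧ (∀ x, 0 ≤ H x) ∧ 0 < ∫ x, H x ∂μ ∧
      ∀ z ∈ K, (∫ x, H x ∂μ) / 2 ≤ ∫ x, min (H x) (H (z⁻¹ * x)) ∂μ := by
  -- With both tolerances 1/8, `∫ |g| ≥ 7/8` while a translate of `g` differs from `g` by at most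
  -- 3/8, less than half of `∫ |g|`.
  obtain ⟨v, hv1, hv2⟩ := hm.exists_norm_translate_sub_le hK (ε := 1 / 8) (by norm_num)
  obtain ⟨g, hg1, hg, hgm, hgc⟩ := exists_hasCompactSupport_eLpNorm_sub_le ENNReal.one_ne_top
    (Lp.memLp v) (ε := ENNReal.ofReal (1 / 8)) (by simp)
  let w : Lp ℝ 1 μ := hgm.toLp
  have hvw : ‖v - w‖ ≤ 1 / 8 := by
    have h1 : ‖v - w‖ₑ = eLpNorm (⇑v - g) 1 μ := by
      conv_lhs => rw [← Lp.toLp_coeFn v (Lp.memLp v)]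
      rw [← MemLp.toLp_sub, Lp.enorm_toLp]
    rw [← h1, ← ofReal_norm] at hg1
    exact (ENNReal.ofReal_le_ofReal_iff (by norm_num)).1 hg1
  have hgi : Integrable g μ := hg.integrable_of_hasCompactSupport hgc
  have hint : 7 / 8 ≤ ∫ x, |g x| ∂μ := by
    have h1 : |∫ s, v s ∂μ - ∫ s, w s ∂μ| ≤ 1 / 8 := by
      rw [← integral_sub (L1.integrable_coeFn v) (L1.integrable_coeFn w)]
      refine le_trans ?_ hvw
      rw [L1.norm_eq_integral_norm]
      refine (norm_integral_le_integral_norm (fun a => v a - w a)).trans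
        (integral_congr_ae ?_).le
      filter_upwards [Lp.coeFn_sub v w] with a ha
      rw [ha, Pi.sub_apply]
    rw [hv1, integral_congr_ae hgm.coeFn_toLp] at h1
    have h2 : ∫ x, g x ∂μ ≤ ∫ x, |g x| ∂μ := integral_mono hgi hgi.abs fun x => le_abs_self _
    have := (abs_le.1 h1).2
    linarith
  refine ⟨fun x => |g x|, hg.abs, hgc.norm, fun x => abs_nonneg _, by linarith, fun z hz => ?_⟩
  have hgz : Continuous fun x => g (z⁻¹ * x) := by fun_prop
  have hgzc : HasCompactSupport fun x => g (z⁻¹ * x) := hgc.comp_mul_left z⁻¹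
  have hgzi : Integrable (fun x => g (z⁻¹ * x)) μ := hgz.integrable_of_hasCompactSupport hgzc
  have h1 : ∫ x, |g (z⁻¹ * x) - g x| ∂μ ≤ 3 / 8 := by
    refine le_of_eq_of_le
      (norm_sub_toLp (hgm.comp_measurePreserving (measurePreserving_mul_left μ z⁻¹)) hgm).symm ?_
    change ‖translate μ z w - w‖ ≤ 3 / 8
    calc ‖translate μ z w - w‖ = ‖(v - w) - translate μ z (v - w) + (translate μ z v - v)‖ := by
          rw [map_sub]; congr 1; abel
      _ ≤ ‖v - w‖ + ‖translate μ z (v - w)‖ + ‖translate μ z v - v‖ :=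
          (norm_add_le _ _).trans (add_le_add_left (norm_sub_le _ _) _)
      _ ≤ 1 / 8 + 1 / 8 + 1 / 8 := by
          rw [LinearIsometry.norm_map]
          exact add_le_add (add_le_add hvw hvw) (hv2 z hz)
      _ = 3 / 8 := by norm_num
  have hmin : ∀ x, |g x| - |g (z⁻¹ * x) - g x| ≤ min |g x| |g (z⁻¹ * x)| := fun x => by
    refine le_min (sub_le_self _ (abs_nonneg _)) ?_
    have := abs_sub_abs_le_abs_sub (g x) (g (z⁻¹ * x))
    rw [abs_sub_comm] at this
    linarith
  calc (∫ x, |g x| ∂μ) / 2 ≤ (∫ x, |g x| ∂μ) - ∫ x, |g (z⁻¹ * x) - g x| ∂μ := by linarith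
    _ = ∫ x, (|g x| - |g (z⁻¹ * x) - g x|) ∂μ := (integral_sub hgi.abs (hgzi.sub hgi).abs).symm
    _ ≤ _ := integral_mono (hgi.abs.sub (hgzi.sub hgi).abs) (hgi.abs.inf hgzi.abs) hmin

theorem IsLeftInvariantMean.exists_integral_eq_one {m : Lp ℝ ∞ μ →ₗ[ℝ] ℝ}
    (hm : IsLeftInvariantMean m) {K : Set G} (hK : IsCompact K) :
    ∃ H : G → ℝ, Continuous H ∧ HasCompactSupport H ∧ (∀ x, 0 ≤ H x) ∧ ∫ x, H x ∂μ = 1 ∧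
      ∀ z ∈ K, 1 / 2 ≤ ∫ x, min (H x) (H (z⁻¹ * x)) ∂μ := by
  obtain ⟨H, h1, h2, h3, h4, h5⟩ := hm.exists_integral_min_ge hK
  have hI : 0 < (∫ x, H x ∂μ)⁻¹ := inv_pos.2 h4
  refine ⟨fun x => (∫ x, H x ∂μ)⁻¹ * H x, by fun_prop, h2.mul_left,
    fun x => mul_nonneg hI.le (h3 x), ?_, fun z hz => ?_⟩
  · rw [integral_const_mul, inv_mul_cancel₀ h4.ne']
  · simp only [← mul_min_of_nonneg _ _ hI.le]
    rw [integral_const_mul]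
    calc (1 : ℝ) / 2 = (∫ x, H x ∂μ)⁻¹ * ((∫ x, H x ∂μ) / 2) := by field_simp
      _ ≤ _ := mul_le_mul_of_nonneg_left (h5 z hz) hI.le

end Reiter

/-! ### Duality with test functions adapted to a compact set. -/

section TestFunctions

variable {G : Type*} [Group G] [TopologicalSpace G] [IsTopologicalGroup G] [LocallyCompactSpace G]
  [T2Space G] [MeasurableSpace G] [BorelSpace G] (μ : Measure G) [μ.IsHaarMeasure] [μ.Regular]

theorem integral_inv_mul_modular_inv {φ : G → ℝ} (hφ : Continuous φ) (hφc : HasCompactSupport φ) :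
    ∫ y, φ y⁻¹ * (modular y)⁻¹ ∂μ = ∫ y, φ y ∂μ := by
  have h := integral_comp_inv_of_hasCompactSupport μ (φ := fun y => φ y⁻¹) (by fun_prop)
    hφc.comp_inv
  simpa only [inv_inv] using h.symm

/-- The formula passes from continuous compactly supported functions to `H` by expanding `H Δ⁻¹` in
a series of them. -/
theorem integral_comp_inv {H : G → ℝ} (hH : Integrable (fun x => H x * (modular x)⁻¹) μ) :
    ∫ y, H y⁻¹ ∂μ = ∫ y, H y * (modular y)⁻¹ ∂μ := by
  have hΔ := continuous_modular (G := G)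
  have hH1 := memLp_one_iff_integrable.2 hH
  obtain ⟨ψ, hψ, hψc, hψs, hψH⟩ := exists_hasSum_continuous le_rfl ENNReal.one_ne_top hH1
  have hψi : ∀ n, Integrable (ψ n) μ := fun n => (hψ n).integrable_of_hasCompactSupport (hψc n)
  have hsum : Summable fun n => ∫ y, ‖ψ n y‖ ∂μ := by
    have h1 : ∀ n, eLpNorm (ψ n) 1 μ = ‖∫ y, ‖ψ n y‖ ∂μ‖ₑ := fun n => by
      rw [eLpNorm_one_eq_lintegral_enorm, ← ofReal_integral_norm_eq_lintegral_enorm (hψi n),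
        ← ofReal_norm, Real.norm_of_nonneg (integral_nonneg fun y => norm_nonneg _)]
    simp only [h1] at hψs
    exact (tsum_enorm_ne_top_iff_summable_norm.1
      (hψs.trans_lt (ENNReal.add_lt_top.2 ⟨hH1.2, by simp⟩)).ne).of_norm
  have s1 := (integrable_and_hasSum_integral hψi hsum hψH).2
  let F : ℕ → G → ℝ := fun n y => ψ n y⁻¹ * modular y⁻¹
  have hFc : ∀ n, Continuous (F n) := fun n => by fun_prop
  have hFcs : ∀ n, HasCompactSupport (F n) := fun n => (hψc n).comp_inv.mul_right
  have hF1 : ∀ n, ∫ y, F n y ∂μ = ∫ y, ψ n y ∂μ := fun n => by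
    rw [← integral_inv_mul_modular_inv μ (hψ n) (hψc n)]
    simp only [F, modular_inv]
  have hF2 : ∀ n, ∫ y, ‖F n y‖ ∂μ = ∫ y, ‖ψ n y‖ ∂μ := fun n => by
    rw [← integral_inv_mul_modular_inv μ (hψ n).norm (hψc n).norm]
    simp only [F, norm_mul, modular_inv, norm_inv, Real.norm_of_nonneg (modular_pos _).le]
  have hFH : ∀ᵐ y ∂μ, HasSum (fun n => F n y) (H y⁻¹) := by
    have h' : ∀ᵐ y ∂μ, HasSum (fun n => ψ n y⁻¹) (H y⁻¹ * (modular y⁻¹)⁻¹) :=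
      (quasiMeasurePreserving_inv μ).ae hψH
    filter_upwards [h'] with y hy
    have := hy.mul_right (modular y⁻¹)
    rwa [mul_assoc, inv_mul_cancel₀ (modular_pos _).ne', mul_one] at this
  have s2 := (integrable_and_hasSum_integral
    (fun n => (hFc n).integrable_of_hasCompactSupport (hFcs n))
    (by simpa only [hF2] using hsum) hFH).2
  simp only [hF1] at s2
  exact s2.unique s1

/-- Fubini's theorem for the pairing of `g * f` with a test function `k`. -/
theorem integral_mul_conv_eq {f : G → ℝ≥0} (hf : Measurable f)
    (hloc : LocallyIntegrable (fun x => (f x : ℝ)) μ)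
    [IsFiniteMeasureOnCompacts (μ.withDensity fun x => (f x : ℝ≥0∞))]
    {g k : G → ℝ} (hg : Continuous g)
    (hgc : HasCompactSupport g) (hk : Continuous k) (hkc : HasCompactSupport k) :
    ∫ x, k x * ∫ y, g y * f (y⁻¹ * x) ∂μ ∂μ =
      ∫ z, ∫ y, g y * k (y * z) ∂μ ∂(μ.withDensity fun x => (f x : ℝ≥0∞)) := by
  have hΔ : Continuous fun z : G => (modular z)⁻¹ :=
    continuous_modular.inv₀ fun y => (modular_pos y).ne'
  -- Absorbing `f` into the measure leaves a continuous compactly supported integrand on `G × G`, so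
  -- Fubini needs only measures finite on compact sets.
  have e1 : ∀ x, ∫ y, g y * f (y⁻¹ * x) ∂μ =
      ∫ z, g (x * z⁻¹) * (modular z)⁻¹ ∂(μ.withDensity fun x => (f x : ℝ≥0∞)) := fun x => by
    have hcomp : HasCompactSupport fun z => g (x * z⁻¹) * (modular z)⁻¹ :=
      (hgc.comp_mul_left x).comp_inv.mul_right
    have hint : Integrable (fun z => (g (x * z⁻¹) * f z) * (modular z)⁻¹) μ := by
      refine (hloc.integrable_smul_left_of_hasCompactSupport
        (g := fun z => g (x * z⁻¹) * (modular z)⁻¹) (by fun_prop) hcomp).congr ?_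
      exact Filter.Eventually.of_forall fun z => by simp only [smul_eq_mul]; ring
    rw [integral_withDensity_eq_integral_smul hf, ← integral_mul_left_eq_self _ x]
    have h := integral_comp_inv μ hint
    simp only [inv_inv] at h
    calc _ = ∫ y, g (x * y) * f y⁻¹ ∂μ := by simp
      _ = _ := h
      _ = _ := integral_congr_ae (Filter.Eventually.of_forall fun z => by
        simp only [NNReal.smul_def, smul_eq_mul]; ring)
  have e2 : ∀ z, ∫ y, g y * k (y * z) ∂μ = ∫ x, k x * (g (x * z⁻¹) * (modular z)⁻¹) ∂μ :=
    fun z => by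
      have h := integral_comp_mul_right μ (fun x => k x * g (x * z⁻¹)) z
      simp only [mul_inv_cancel_right, smul_eq_mul] at h
      rw [← integral_const_mul] at h
      calc _ = ∫ y, k (y * z) * g y ∂μ := by simp only [mul_comm]
        _ = _ := h
        _ = _ := integral_congr_ae (Filter.Eventually.of_forall fun z => by simp only; ring)
  simp only [e1, e2, ← integral_const_mul]
  apply integral_integral_swap_of_hasCompactSupport
  · exact (hk.comp continuous_fst).mul ((hg.comp (by fun_prop : Continuous fun z : G × G =>
      z.1 * z.2⁻¹)).mul (hΔ.comp continuous_snd))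
  · have hK := (IsCompact.prod (s := tsupport k) (t := tsupport g) hkc hgc).image
      (show Continuous fun z : G × G => (z.1, z.2⁻¹ * z.1) by fun_prop)
    refine HasCompactSupport.intro hK fun z hz => ?_
    by_contra hne
    simp only [Function.uncurry, mul_eq_zero, not_or] at hne
    exact hz ⟨(z.1, z.1 * z.2⁻¹), ⟨subset_tsupport _ hne.1, subset_tsupport _ hne.2.1⟩, by simp⟩

/-- Hölder's inequality for `k` and `g * f`, both of whose norms are controlled. -/
theorem IsLTp.integral_mul_conv_le {p q : ℝ} (hpq : p.HolderConjugate q) {f : G → ℂ}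
    (hf : IsLTp μ p f) {f₀ : G → ℝ≥0} (hf₀ : ∀ᵐ x ∂μ, f x = ((f₀ x : ℝ) : ℂ)) {g k : G → ℝ}
    (hg : Continuous g) (hgc : HasCompactSupport g) (hk : Continuous k) (hkc : HasCompactSupport k)
    (hg0 : ∀ x, 0 ≤ g x) (hk0 : ∀ x, 0 ≤ k x) (hg1 : ∫ x, g x ^ p ∂μ = 1)
    (hk1 : ∫ x, k x ^ q ∂μ = 1) :
    ∫ x, k x * ∫ y, g y * f₀ (y⁻¹ * x) ∂μ ∂μ ≤ (normT μ p f).toReal := by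
  have hp := hpq.pos
  have hp0 : ENNReal.ofReal p ≠ 0 := by simpa using hp
  let c : G → ℝ := fun x => ∫ y, g y * f₀ (y⁻¹ * x) ∂μ
  have hc0 : ∀ x, 0 ≤ c x := fun x => integral_nonneg fun y => mul_nonneg (hg0 y) (f₀ _).coe_nonneg
  let gc : G → ℂ := fun x => (g x : ℂ)
  have hgm : MemLp gc (ENNReal.ofReal p) μ :=
    (Complex.continuous_ofReal.comp hg).memLp_of_hasCompactSupport
      (hgc.comp_left (g := fun t : ℝ => (t : ℂ)) Complex.ofReal_zero)
  have hconv : ∀ x, conv μ gc f x = (c x : ℂ) := fun x => by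
    have h' : ∀ᵐ y ∂μ, f (y⁻¹ * x) = ((f₀ (y⁻¹ * x) : ℝ) : ℂ) :=
      (quasiMeasurePreserving_inv_mul μ x).ae hf₀
    simp only [c]
    rw [← integral_complex_ofReal]
    refine integral_congr_ae ?_
    filter_upwards [h'] with y hy
    simp only [gc, hy, Complex.ofReal_mul]
  have hcm : MemLp c (ENNReal.ofReal p) μ := by
    refine (hf.conv_memLp gc hgm).norm.congr_norm ?_ (Filter.Eventually.of_forall fun x => ?_)
    · refine ((hf.conv_memLp gc hgm).norm.1).congr (Filter.Eventually.of_forall fun x => ?_)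
      simp only [hconv, Complex.norm_real, Real.norm_of_nonneg (hc0 x)]
    · simp [hconv]
  have hgn : eLpNorm gc (ENNReal.ofReal p) μ ≤ 1 := by
    rw [hgm.eLpNorm_eq_integral_rpow_norm hp0 ENNReal.ofReal_ne_top, ENNReal.toReal_ofReal hp.le]
    simp only [gc, Complex.norm_real, Real.norm_of_nonneg (hg0 _), hg1, Real.one_rpow,
      ENNReal.ofReal_one, le_refl]
  have hcn : (∫ x, c x ^ p ∂μ) ^ (1 / p) ≤ (normT μ p f).toReal := by
    rw [← ENNReal.ofReal_le_iff_le_toReal hf.normT_lt_top.ne]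
    have h1 : eLpNorm (conv μ gc f) (ENNReal.ofReal p) μ ≤ normT μ p f :=
      le_iSup₂_of_le gc hgm (le_iSup_of_le hgn le_rfl)
    refine le_trans (le_of_eq ?_) h1
    rw [(hf.conv_memLp gc hgm).eLpNorm_eq_integral_rpow_norm hp0 ENNReal.ofReal_ne_top,
      ENNReal.toReal_ofReal hp.le]
    simp only [hconv, Complex.norm_real, Real.norm_of_nonneg (hc0 _), one_div]
  have h := integral_mul_le_Lp_mul_Lq_of_nonneg (μ := μ) hpq (f := c) (g := k)
    (Filter.Eventually.of_forall hc0) (Filter.Eventually.of_forall hk0) hcm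
    (hk.memLp_of_hasCompactSupport hkc)
  rw [hk1, Real.one_rpow, mul_one] at h
  calc _ = ∫ x, c x * k x ∂μ := by simp only [c, mul_comm]
    _ ≤ _ := h.trans hcn

/-- With `H` from Reiter's condition, put `E(y) = H(y⁻¹) Δ(y)⁻¹`, `g = E^(1/p)` and `k = E^(1/q)`.
Then `∫ g(y) k(y z) dy = ω_q(z) ∫ H(y)^(1/p) H(z⁻¹ y)^(1/q) dy`, and the last integrand dominates
`min (H y) (H (z⁻¹ y))`. -/
theorem exists_test_functions {m : Lp ℝ ∞ μ →ₗ[ℝ] ℝ} (hm : IsLeftInvariantMean m) {p q : ℝ}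
    (hpq : p.HolderConjugate q) {K : Set G} (hK : IsCompact K) :
    ∃ g k : G → ℝ, Continuous g ∧ HasCompactSupport g ∧ Continuous k ∧ HasCompactSupport k ∧
      (∀ x, 0 ≤ g x) ∧ (∀ x, 0 ≤ k x) ∧ ∫ x, g x ^ p ∂μ = 1 ∧ ∫ x, k x ^ q ∂μ = 1 ∧
      ∀ z ∈ K, weight q z / 2 ≤ ∫ y, g y * k (y * z) ∂μ := by
  obtain ⟨H, hH, hHc, hH0, hH1, hHK⟩ := hm.exists_integral_eq_one hK
  have hp := hpq.pos
  have hq := hpq.symm.pos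
  have hpq1 : p⁻¹ + q⁻¹ = 1 := hpq.inv_add_inv_eq_one
  have hΔ : Continuous fun z : G => (modular z)⁻¹ :=
    continuous_modular.inv₀ fun y => (modular_pos y).ne'
  have hΔ0 : ∀ z : G, 0 ≤ (modular z)⁻¹ := fun z => inv_nonneg.2 (modular_pos z).le
  let E : G → ℝ := fun y => H y⁻¹ * (modular y)⁻¹
  have hE : Continuous E := by fun_prop
  have hEc : HasCompactSupport E := hHc.comp_inv.mul_right
  have hE0 : ∀ y, 0 ≤ E y := fun y => mul_nonneg (hH0 _) (hΔ0 y)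
  have hE1 : ∫ y, E y ∂μ = 1 := by rw [← hH1, ← integral_inv_mul_modular_inv μ hH hHc]
  refine ⟨fun y => E y ^ p⁻¹, fun y => E y ^ q⁻¹,
    hE.rpow_const fun _ => Or.inr (inv_nonneg.2 hp.le),
    hEc.comp_left (g := fun t : ℝ => t ^ p⁻¹) (Real.zero_rpow (inv_ne_zero hp.ne')),
    hE.rpow_const fun _ => Or.inr (inv_nonneg.2 hq.le),
    hEc.comp_left (g := fun t : ℝ => t ^ q⁻¹) (Real.zero_rpow (inv_ne_zero hq.ne')),
    fun x => Real.rpow_nonneg (hE0 x) _, fun x => Real.rpow_nonneg (hE0 x) _, ?_, ?_,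
    fun z hz => ?_⟩
  · simp only [Real.rpow_inv_rpow (hE0 _) hp.ne', hE1]
  · simp only [Real.rpow_inv_rpow (hE0 _) hq.ne', hE1]
  let φ : G → ℝ := fun y => H y ^ p⁻¹ * H (z⁻¹ * y) ^ q⁻¹
  have hφ : Continuous φ := (hH.rpow_const fun _ => Or.inr (inv_nonneg.2 hp.le)).mul
    ((hH.comp (continuous_const_mul z⁻¹)).rpow_const fun _ => Or.inr (inv_nonneg.2 hq.le))
  have hφc : HasCompactSupport φ := (hHc.comp_left (g := fun t : ℝ => t ^ p⁻¹)
    (Real.zero_rpow (inv_ne_zero hp.ne'))).mul_right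
  have h1 : ∀ y, E y ^ p⁻¹ * E (y * z) ^ q⁻¹ = weight q z * (φ y⁻¹ * (modular y)⁻¹) := fun y => by
    have hy := modular_pos y
    have hz := modular_pos z
    simp only [E, φ, weight, modular_mul, mul_inv_rev]
    rw [Real.mul_rpow (hH0 _) (hΔ0 y), Real.mul_rpow (hH0 _) (by positivity),
      Real.mul_rpow (hΔ0 _) (hΔ0 _), Real.rpow_neg hz.le, one_div, Real.inv_rpow hz.le]
    have : (modular y)⁻¹ = (modular y)⁻¹ ^ p⁻¹ * (modular y)⁻¹ ^ q⁻¹ := by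
      rw [← Real.rpow_add (inv_pos.2 hy), hpq1, Real.rpow_one]
    conv_rhs => rw [this]
    ring
  simp only [h1]
  rw [integral_const_mul, integral_inv_mul_modular_inv μ hφ hφc, div_eq_mul_one_div]
  refine mul_le_mul_of_nonneg_left ((hHK z hz).trans ?_) (weight_pos q z).le
  have hHz : Continuous fun y => H (z⁻¹ * y) := by fun_prop
  refine integral_mono ((hH.integrable_of_hasCompactSupport hHc).inf
    (hHz.integrable_of_hasCompactSupport (hHc.comp_mul_left z⁻¹)))
    (hφ.integrable_of_hasCompactSupport hφc) fun y => ?_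
  have hmin : 0 ≤ min (H y) (H (z⁻¹ * y)) := le_min (hH0 _) (hH0 _)
  calc min (H y) (H (z⁻¹ * y)) =
        min (H y) (H (z⁻¹ * y)) ^ p⁻¹ * min (H y) (H (z⁻¹ * y)) ^ q⁻¹ := by
        rw [← Real.rpow_add_of_nonneg hmin (by positivity) (by positivity), hpq1, Real.rpow_one]
    _ ≤ φ y := mul_le_mul (Real.rpow_le_rpow hmin (min_le_left _ _) (by positivity))
        (Real.rpow_le_rpow hmin (min_le_right _ _) (by positivity)) (Real.rpow_nonneg hmin _)
        (Real.rpow_nonneg (hH0 _) _)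

end TestFunctions

/-! ### Positive `L^T_p` functions lie in the weighted `L^1` space. -/

section Converse

variable {G : Type*} [Group G] [TopologicalSpace G] [IsTopologicalGroup G] [LocallyCompactSpace G]
  [T2Space G] [MeasurableSpace G] [BorelSpace G] (μ : Measure G) [μ.IsHaarMeasure]

omit [LocallyCompactSpace G] [T2Space G] in
theorem continuous_integral_mul_mul {g k : G → ℝ} (hg : Continuous g) (hgc : HasCompactSupport g)
    (hk : Continuous k) : Continuous fun z => ∫ y, g y * k (y * z) ∂μ := by
  rw [← continuousOn_univ]
  refine continuousOn_integral_of_compact_support (k := tsupport g) hgc ?_ fun z y _ hy => ?_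
  · simp only [Function.uncurry_def]
    fun_prop
  · rw [image_eq_zero_of_notMem_tsupport hy, zero_mul]

omit [LocallyCompactSpace G] [BorelSpace G] [μ.IsHaarMeasure] [T2Space G] in
theorem hasCompactSupport_integral_mul_mul {g k : G → ℝ} (hgc : HasCompactSupport g)
    (hkc : HasCompactSupport k) : HasCompactSupport fun z => ∫ y, g y * k (y * z) ∂μ := by
  have hK := (IsCompact.prod (s := tsupport g) (t := tsupport k) hgc hkc).image
    (show Continuous fun z : G × G => z.1⁻¹ * z.2 by fun_prop)
  refine HasCompactSupport.intro hK fun z hz => integral_eq_zero_of_ae ?_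
  refine Filter.Eventually.of_forall fun y => ?_
  by_contra hne
  simp only [Pi.zero_apply, mul_eq_zero, not_or] at hne
  exact hz ⟨(y, y * z), ⟨subset_tsupport _ hne.1, subset_tsupport _ hne.2⟩, by simp⟩

variable [μ.Regular]

/-- The test functions depend on `K` but the bound does not, which is what allows `K` to grow. -/
theorem IsLTp.setLIntegral_weight_le {m : Lp ℝ ∞ μ →ₗ[ℝ] ℝ} (hm : IsLeftInvariantMean m)
    {p q : ℝ} (hpq : p.HolderConjugate q) {f : G → ℂ} (hf : IsLTp μ p f) {f₀ : G → ℝ≥0}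
    (hf₀m : Measurable f₀) (hloc : LocallyIntegrable (fun x => (f₀ x : ℝ)) μ)
    [IsFiniteMeasureOnCompacts (μ.withDensity fun x => (f₀ x : ℝ≥0∞))]
    (hf₀ : ∀ᵐ x ∂μ, f x = ((f₀ x : ℝ) : ℂ)) {K : Set G} (hK : IsCompact K) :
    ∫⁻ x in K, ENNReal.ofReal (weight q x) ∂(μ.withDensity fun x => (f₀ x : ℝ≥0∞)) ≤
      ENNReal.ofReal (2 * (normT μ p f).toReal) := by
  obtain ⟨g, k, hg, hgc, hk, hkc, hg0, hk0, hg1, hk1, hgk⟩ := exists_test_functions μ hm hpq hK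
  set ν := μ.withDensity fun x => (f₀ x : ℝ≥0∞)
  let θ : G → ℝ := fun z => ∫ y, g y * k (y * z) ∂μ
  have hθ : Continuous θ := continuous_integral_mul_mul μ hg hgc hk
  have hθi : Integrable θ ν :=
    hθ.integrable_of_hasCompactSupport (hasCompactSupport_integral_mul_mul μ hgc hkc)
  have hθ0 : ∀ z, 0 ≤ θ z := fun z => integral_nonneg fun y => mul_nonneg (hg0 _) (hk0 _)
  have h1 : ∫ z, θ z ∂ν ≤ (normT μ p f).toReal := by
    rw [← integral_mul_conv_eq μ hf₀m hloc hg hgc hk hkc]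
    exact hf.integral_mul_conv_le μ hpq hf₀ hg hgc hk hkc hg0 hk0 hg1 hk1
  calc _ ≤ ∫⁻ x in K, ENNReal.ofReal (2 * θ x) ∂ν := by
        refine setLIntegral_mono' hK.measurableSet fun x hx => ENNReal.ofReal_le_ofReal ?_
        linarith [hgk x hx]
    _ ≤ ∫⁻ x, ENNReal.ofReal (2 * θ x) ∂ν := setLIntegral_le_lintegral _ _
    _ = ENNReal.ofReal (∫ x, 2 * θ x ∂ν) := (ofReal_integral_eq_lintegral_ofReal
        (hθi.const_mul 2) (Filter.Eventually.of_forall fun x => by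
          simpa using hθ0 x)).symm
    _ ≤ _ := ENNReal.ofReal_le_ofReal (by rw [integral_const_mul]; linarith)

/-- An a.e. positive element of `L^T_p(G)` lies in `L^1(G, ω_q)`, if `G` is amenable. -/
theorem IsLTp.memL1Weighted {m : Lp ℝ ∞ μ →ₗ[ℝ] ℝ} (hm : IsLeftInvariantMean m)
    {p q : ℝ} (hpq : p.HolderConjugate q) {f : G → ℂ} (hf : IsLTp μ p f) (hpos : IsPos μ f) :
    MemL1Weighted μ (weight q) f := by
  have hp1 : 1 ≤ ENNReal.ofReal p := by simpa using hpq.lt.le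
  have hω := continuous_weight (G := G) q
  let f₀ : G → ℝ≥0 := fun x => (hf.memLp.1.mk f x).re.toNNReal
  have hf₀m : Measurable f₀ :=
    (Complex.measurable_re.comp hf.memLp.1.stronglyMeasurable_mk.measurable).real_toNNReal
  have hf₀ : ∀ᵐ x ∂μ, f x = ((f₀ x : ℝ) : ℂ) := by
    filter_upwards [hf.memLp.1.ae_eq_mk, hpos] with x h1 h2
    simp only [f₀, ← h1, Real.coe_toNNReal _ h2.1]
    exact Complex.ext (by simp) (by simpa using h2.2)
  have hloc : LocallyIntegrable (fun x => (f₀ x : ℝ)) μ := by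
    have hfl : MemLp (fun x => (f₀ x : ℝ)) (ENNReal.ofReal p) μ := by
      refine hf.memLp.congr_norm hf₀m.coe_nnreal_real.aestronglyMeasurable ?_
      filter_upwards [hf₀] with x hx
      rw [hx, Complex.norm_real]
    exact hfl.locallyIntegrable hp1
  set ν := μ.withDensity fun x => (f₀ x : ℝ≥0∞) with hν
  have : IsFiniteMeasureOnCompacts ν := ⟨fun K hK => by
    rw [hν, withDensity_apply _ hK.measurableSet]
    have := (hloc.integrableOn_isCompact hK).2
    simpa [HasFiniteIntegral, enorm_eq_nnnorm] using this⟩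
  -- Almost everywhere off the union of these countably many compact supports `f` vanishes; thus `f`
  -- has a σ-compact carrier even if `G` is not σ-compact.
  obtain ⟨ψ, -, hψc, -, hψ⟩ := exists_hasSum_continuous hp1 ENNReal.ofReal_ne_top hf.memLp
  let K : ℕ → Set G := fun n => ⋃ i ∈ Finset.range n, tsupport (ψ i)
  have hK : ∀ n, IsCompact (K n) := fun n => (Finset.range n).isCompact_biUnion fun i _ => hψc i
  have hKm : Monotone K := fun a b hab => Set.biUnion_subset_biUnion_left fun i hi =>
    Finset.mem_range.2 ((Finset.mem_range.1 hi).trans_le hab)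
  let ρ := ν.withDensity fun x => ENNReal.ofReal (weight q x)
  have hρK : ρ (⋃ n, K n) ≤ ENNReal.ofReal (2 * (normT μ p f).toReal) := by
    rw [hKm.measure_iUnion]
    refine iSup_le fun n => ?_
    rw [withDensity_apply _ (hK n).measurableSet]
    exact hf.setLIntegral_weight_le μ hm hpq hf₀m hloc hf₀ (hK n)
  have hρ0 : ρ (⋃ n, K n)ᶜ = 0 := by
    refine withDensity_absolutelyContinuous _ _ ?_
    rw [hν, withDensity_apply _ (MeasurableSet.iUnion fun n => (hK n).measurableSet).compl]
    rw [lintegral_eq_zero_iff hf₀m.coe_nnreal_ennreal]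
    refine (ae_restrict_iff' (MeasurableSet.iUnion fun n => (hK n).measurableSet).compl).2 ?_
    filter_upwards [hψ, hf₀] with x h1 h2 hx
    have h3 : ∀ n, ψ n x = 0 := fun n => image_eq_zero_of_notMem_tsupport fun h =>
      hx (Set.mem_iUnion.2 ⟨n + 1, Set.mem_biUnion (Finset.mem_range.2 n.lt_succ_self) h⟩)
    simp only [h3] at h1
    have h4 := h1.unique hasSum_zero
    rw [h2] at h4
    simpa using h4
  have hρ : ρ Set.univ < ∞ := by
    rw [← Set.union_compl_self (⋃ n, K n)]
    refine (measure_union_le _ _).trans_lt ?_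
    rw [hρ0, add_zero]
    exact hρK.trans_lt ENNReal.ofReal_lt_top
  refine ⟨hf.memLp.1.mul (Complex.continuous_ofReal.comp hω).aestronglyMeasurable, ?_⟩
  rw [withDensity_apply _ MeasurableSet.univ, Measure.restrict_univ,
    lintegral_withDensity_eq_lintegral_mul _ hf₀m.coe_nnreal_ennreal
      hω.measurable.ennreal_ofReal] at hρ
  refine lt_of_eq_of_lt (lintegral_congr_ae ?_) hρ
  filter_upwards [hf₀] with x hx
  rw [hx, enorm_mul, Pi.mul_apply, ← ofReal_norm (weight q x : ℂ), Complex.norm_real,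
    Real.norm_of_nonneg (weight_pos q x).le]
  congr 1
  rw [← ofReal_norm, Complex.norm_real, Real.norm_of_nonneg (f₀ x).coe_nonneg,
    ENNReal.ofReal_coe_nnreal]

end Converse

end LpT

theorem theoremt4 {G : Type*} [Group G] [TopologicalSpace G] [IsTopologicalGroup G]
    [LocallyCompactSpace G] [T2Space G] [MeasurableSpace G] [BorelSpace G]
    (μ : Measure G) [μ.IsHaarMeasure] [μ.Regular] (hG : LpT.IsAmenable μ)
    (p q : ℝ) (hp : 1 < p) (hpq : 1 / p + 1 / q = 1) :
    {f : G → ℂ | LpT.MemL1Weighted μ (LpT.weight q) f ∧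
        MemLp f (ENNReal.ofReal p) μ ∧ LpT.IsPos μ f} =
      {f : G → ℂ | LpT.IsLTp μ p f ∧ LpT.IsPos μ f} := by
  have hc : p.HolderConjugate q :=
    Real.holderConjugate_iff.2 ⟨hp, by simpa only [one_div] using hpq⟩
  obtain ⟨m, h1, h2, h3⟩ := hG
  ext f
  constructor
  · rintro ⟨hw, hf, hpos⟩
    exact ⟨LpT.isLTp_of_memL1Weighted μ hc hw hf, hpos⟩
  · rintro ⟨hf, hpos⟩
    exact ⟨hf.memL1Weighted μ ⟨h1, h2, h3⟩ hc hpos, hf.memLp, hpos⟩
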